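/- Let $n\ge 1$ be an integer and let $q\in\mathbb{C}$ with $q\neq 0$ and $|q|\neq 1$. For a polynomial $P\in\mathbb{C}[x]$ let $\mathcal{A}$ be the algebra over $\mathbb{C}$ generated by $u,v,Z,Z^{-1}$ with relations $ZZ^{-1}=Z^{-1}Z=1$, $ZuZ^{-1}=q^2u$, $ZvZ^{-1}=q^{-2}v$, $uv=P(q^{-1}Z)$, $vu=P(qZ)$, and let $\mathcal{A}_+\subset\mathcal{A}$ be the subalgebra generated by $u,v,Z$. For $t\in\mathbb{C}^\times$ let $g_t$ be the automorphism with $g_t(u)=tu$, $g_t(v)=t^{-1}v$, $g_t(Z)=Z$; a linear map $T\colon\mathcal{A}_+\to\mathbb{C}$ is a $g_t$-twisted trace if $T(ab)=T(b\,g_t(a))$ for all $a,b\in\mathcal{A}_+$. Filter $\mathcal{A}_+$ by $\deg u=\deg v=n$, $\deg Z=2$, so that $\mathcal{A}_{+,\le k}$ is the span of all words in $u,v,Z$ of total degree at most $k$. Call $T$ nondegenerate if for every integer $k\ge 0$ the bilinear form $(a,b)\mapsto T(ab)$ on $\mathcal{A}_{+,\le k}$ is nondegenerate. Then there is a countable set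 $Z_0\subset\mathbb{C}$ containing $1,q^{-2},q^{-4},\dots$ such that for every nonzero $t\in\mathbb{C}\setminus Z_0$ there is a countable union $X$ of algebraic hypersurfaces (zero sets of nonconstant polynomials) in $\mathbb{C}^{2n+1}$ with the following property. For every $(c_0,\dots,c_n,t_0,\dots,t_{n-1})\in\mathbb{C}^{2n+1}\setminus X$ there is exactly one $g_t$-twisted trace $T$ on the algebra $\mathcal{A}_+$ with parameter $P(x)=\sum_{i=0}^n c_ix^i$ such that $T(Z^i)=t_i$ for $0\le i\le n-1$, and this trace is nondegenerate. -/

import Mathlib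

namespace QWeyl

open Polynomial

/-- The generators `u`, `v`, `Z`, `Z⁻¹` of the generalized `q`-Weyl algebra. -/
inductive Gen
  | u
  | v
  | z
  | zInv

/-- Abbreviation for a generator of the free algebra. -/
noncomputable abbrev fg (x : Gen) : FreeAlgebra ℂ Gen := FreeAlgebra.ι ℂ x

/-- The defining relations: `Z` is invertible, `Z u Z⁻¹ = q² u`, `Z v Z⁻¹ = q⁻² v`,
`u v = P(q⁻¹ Z)`, `v u = P(q Z)`. -/
inductive Rel (q : ℂ) (P : ℂ[X]) : FreeAlgebra ℂ Gen → FreeAlgebra ℂ Gen → Prop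
  | z_zInv : Rel q P (fg .z * fg .zInv) 1
  | zInv_z : Rel q P (fg .zInv * fg .z) 1
  | conj_u : Rel q P (fg .z * fg .u * fg .zInv) (q ^ 2 • fg .u)
  | conj_v : Rel q P (fg .z * fg .v * fg .zInv) ((q ^ 2)⁻¹ • fg .v)
  | u_v : Rel q P (fg .u * fg .v) (aeval (q⁻¹ • fg .z) P)
  | v_u : Rel q P (fg .v * fg .u) (aeval (q • fg .z) P)

/-- The generalized `q`-Weyl algebra `𝒜` with polynomial parameter `P`. -/
abbrev A (q : ℂ) (P : ℂ[X]) : Type := RingQuot (Rel q P)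

/-- The image of a generator in `𝒜`. -/
noncomputable def gen (q : ℂ) (P : ℂ[X]) (x : Gen) : A q P :=
  RingQuot.mkAlgHom ℂ (Rel q P) (fg x)

/-- The subalgebra `𝒜₊` of `𝒜` generated by `u`, `v`, `Z`. -/
noncomputable def APlus (q : ℂ) (P : ℂ[X]) : Subalgebra ℂ (A q P) :=
  Algebra.adjoin ℂ {gen q P .u, gen q P .v, gen q P .z}

/-- The three generators of `𝒜₊`. -/
inductive GenPlus
  | u
  | v
  | z

/-- A generator of `𝒜₊`, as one of the generators of `𝒜`. -/
def GenPlus.toGen : GenPlus → Gen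
  | .u => .u
  | .v => .v
  | .z => .z

theorem gen_mem_APlus (q : ℂ) (P : ℂ[X]) (x : GenPlus) : gen q P x.toGen ∈ APlus q P := by
  cases x <;> exact Algebra.subset_adjoin (by simp [GenPlus.toGen])

/-- The generators `u`, `v`, `Z` as elements of `𝒜₊`. -/
noncomputable def genPlus (q : ℂ) (P : ℂ[X]) (x : GenPlus) : APlus q P :=
  ⟨gen q P x.toGen, gen_mem_APlus q P x⟩

/-- The scalars by which `g_t` acts on the generators: `u ↦ t u`, `v ↦ t⁻¹ v`, and `Z`, `Z⁻¹`
are fixed. -/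
noncomputable def scal (t : ℂˣ) : Gen → ℂ
  | .u => t
  | .v => (t : ℂ)⁻¹
  | .z => 1
  | .zInv => 1

/-- The map from the free algebra to `𝒜` that induces `g_t`. -/
noncomputable def gFree (q : ℂ) (P : ℂ[X]) (t : ℂˣ) : FreeAlgebra ℂ Gen →ₐ[ℂ] A q P :=
  FreeAlgebra.lift ℂ fun x => scal t x • gen q P x

theorem gFree_rel (q : ℂ) (P : ℂ[X]) (t : ℂˣ) ⦃x y : FreeAlgebra ℂ Gen⦄ (h : Rel q P x y) :
    gFree q P t x = gFree q P t y := by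
  have ht : (t : ℂ) ≠ 0 := t.ne_zero
  have hg : ∀ x, gFree q P t (fg x) = scal t x • gen q P x := fun x => by simp [gFree, fg]
  have hm : ∀ x, RingQuot.mkAlgHom ℂ (Rel q P) (fg x) = gen q P x := fun _ => rfl
  have hk := RingQuot.mkAlgHom_rel ℂ h
  cases h <;> simp only [map_mul, map_one, map_smul, ← Polynomial.aeval_algHom_apply, hg, hm,
    scal, one_smul, smul_mul_assoc, mul_smul_comm, smul_smul, mul_inv_cancel₀ ht,
    inv_mul_cancel₀ ht] at hk ⊢ <;> rw [hk]
  all_goals rw [smul_smul, mul_comm]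

/-- The automorphism `g_t` of `𝒜`: `g_t(u) = t u`, `g_t(v) = t⁻¹ v`, `g_t(Z) = Z`. -/
noncomputable def g (q : ℂ) (P : ℂ[X]) (t : ℂˣ) : A q P →ₐ[ℂ] A q P :=
  RingQuot.liftAlgHom ℂ ⟨gFree q P t, gFree_rel q P t⟩

theorem g_gen (q : ℂ) (P : ℂ[X]) (t : ℂˣ) (x : Gen) :
    g q P t (gen q P x) = scal t x • gen q P x := by
  rw [g, gen, RingQuot.liftAlgHom_mkAlgHom_apply]
  simp [gFree, fg, gen]

theorem g_mem_APlus (q : ℂ) (P : ℂ[X]) (t : ℂˣ) (a : APlus q P) :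
    g q P t (a : A q P) ∈ APlus q P := by
  have h : APlus q P ≤ (APlus q P).comap (g q P t) := by
    refine Algebra.adjoin_le ?_
    rintro x (rfl | rfl | rfl) <;> simp only [SetLike.mem_coe, Subalgebra.mem_comap, g_gen]
    · exact Subalgebra.smul_mem _ (gen_mem_APlus q P .u) _
    · exact Subalgebra.smul_mem _ (gen_mem_APlus q P .v) _
    · exact Subalgebra.smul_mem _ (gen_mem_APlus q P .z) _
  exact h a.2

/-- The restriction of `g_t` to `𝒜₊`. -/
noncomputable def gPlus (q : ℂ) (P : ℂ[X]) (t : ℂˣ) : APlus q P →ₐ[ℂ] APlus q P :=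
  ((g q P t).comp (APlus q P).val).codRestrict (APlus q P) (g_mem_APlus q P t)

/-- A `g_t`-twisted trace on `𝒜₊`: a linear functional with `T(a b) = T(b g_t(a))`. -/
def IsTwistedTrace {q : ℂ} {P : ℂ[X]} (t : ℂˣ) (T : APlus q P →ₗ[ℂ] ℂ) : Prop :=
  ∀ a b : APlus q P, T (a * b) = T (b * gPlus q P t a)

/-- The filtration degrees of the generators: `deg u = deg v = n`, `deg Z = 2`. -/
def GenPlus.deg (n : ℕ) : GenPlus → ℕ
  | .u => n
  | .v => n
  | .z => 2

/-- The filtration piece `𝒜₊,≤k`: the span of all words in `u`, `v`, `Z` of total degree at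
most `k`, where `deg u = deg v = n` and `deg Z = 2`. -/
noncomputable def filtration (q : ℂ) (P : ℂ[X]) (n k : ℕ) : Submodule ℂ (APlus q P) :=
  Submodule.span ℂ {x | ∃ w : List GenPlus,
    (w.map (GenPlus.deg n)).sum ≤ k ∧ x = (w.map (genPlus q P)).prod}

/-- The bilinear form `(a, b) = T(a b)` on `𝒜₊,≤k`. -/
noncomputable def traceForm {q : ℂ} {P : ℂ[X]} (n k : ℕ) (T : APlus q P →ₗ[ℂ] ℂ) :
    LinearMap.BilinForm ℂ (filtration q P n k) :=
  ((LinearMap.mul ℂ (APlus q P)).compr₂ T).domRestrict₁₂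
    (filtration q P n k) (filtration q P n k)

/-- `T` is nondegenerate: the form `(a, b) = T(a b)` is nondegenerate (on both sides) on every
filtration piece. -/
def IsNondegenerateTrace {q : ℂ} {P : ℂ[X]} (n : ℕ) (T : APlus q P →ₗ[ℂ] ℂ) : Prop :=
  ∀ k : ℕ, LinearMap.Nondegenerate (traceForm n k T)

/-- The polynomial `c₀ + c₁ x + ⋯ + cₙ xⁿ`. -/
noncomputable def param {n : ℕ} (c : Fin (n + 1) → ℂ) : ℂ[X] :=
  ∑ i : Fin (n + 1), C (c i) * X ^ (i : ℕ)

/-- An algebraic hypersurface in affine space `ℂ^σ`: the zero set of a nonconstant polynomial. -/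
def IsAlgebraicHypersurface {σ : Type} (H : Set (σ → ℂ)) : Prop :=
  ∃ f : MvPolynomial σ ℂ, f.totalDegree ≠ 0 ∧ H = {x | MvPolynomial.eval x f = 0}

/-- A countable union of algebraic hypersurfaces in `ℂ^σ`. -/
def IsCountableUnionOfHypersurfaces {σ : Type} (X : Set (σ → ℂ)) : Prop :=
  ∃ S : Set (Set (σ → ℂ)), S.Countable ∧ (∀ H ∈ S, IsAlgebraicHypersurface H) ∧ X = ⋃₀ S

end QWeyl

/-! Grade `𝒜₊` by weight, with `u`, `v`, `Z` in weights 1, -1, 0. When `t` is not a root of unity,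
invariance of `T` under `g_t` kills all nonzero weights, so `T` is known from its moments `m_i =
T(Z^i)`. The trace identity for the pairs `(u, v Z^j)` is the recurrence `∑ c_i d_{i+j} m_{i+j} = 0`
with `d_i = q^{-i} - t q^i`, and all other trace identities follow from it (`isTwistedTrace_iff`).
If `c_n ≠ 0` and `t` is no `q^{-2l}`, the first `n` moments determine a unique solution, and every
sequence is realized by a functional (`exists_linearMap_moments`).

The form pairs weight `e` only with weight `-e`. Since `u^M v^M = Q_M(Z)`, each Gram block is, up to
nonzero row and column factors, the Hankel matrix of `L(Q_M x^{j+l})`, where `L(x^i) = m_i`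
(`IsTwistedTrace.exists_gram_eq`). Its determinant is rational in the parameters with a power of
`c_n` as denominator, so it is nonzero off a hypersurface once it is nonzero at a single point.

Such a point is `P = x^{n-1}(x - 1)`, `m_i = 1/d_i`. As a formal series in `t`, `1/d_i = ∑_k t^k
q^{(2k+1)i}`, so `L(f) = ∑_k t^k f(q^{2k+1})`. As `Q_M` vanishes at exactly the nodes with `k < M`,
the leading coefficient in `t` of the Hankel determinant is a squared Vandermonde determinant times
nonzero values of `Q_M` (`det_hankel_powerSeries_ne_zero`). Each determinant thus excludes finitely
many `t`. No convergence is involved, so `|q| > 1` needs no separate argument. -/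

namespace QWeyl

open Polynomial

/-! ### Hankel determinants as power series and rational functions of `t` -/

/-- A Hankel matrix of power series `∑ₖ tᵏ wₖ xₖ^(j+l)` is nonsingular as soon as the nodes `xₖ`
are distinct and `w` vanishes exactly on an initial segment. -/
theorem det_hankel_powerSeries_ne_zero {x : ℕ → ℂ} (hx : Function.Injective x) {w : ℕ → ℂ}
    {m : ℕ} (hw : ∀ k < m, w k = 0) (hw' : ∀ k, m ≤ k → w k ≠ 0) (N : ℕ) :
    (Matrix.of fun j l : Fin N =>
      PowerSeries.mk fun k => w k * x k ^ ((j : ℕ) + (l : ℕ))).det ≠ 0 := by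
  set S : Matrix (Fin N) (Fin N) (PowerSeries ℂ) := Matrix.of fun j l : Fin N =>
      PowerSeries.mk fun k => w k * x k ^ ((j : ℕ) + (l : ℕ)) with hS
  let y : Fin N → ℂ := fun a => x (m + a)
  have hy : Function.Injective y := fun a b h => by
    have := hx h
    exact Fin.ext (by omega)
  have hV : IsUnit (Matrix.vandermonde y).det :=
    (Matrix.det_vandermonde_ne_zero_iff.2 hy).isUnit
  let f : ℂ →+* PowerSeries ℂ := PowerSeries.C
  let V : Matrix (Fin N) (Fin N) (PowerSeries ℂ) := f.mapMatrix (Matrix.vandermonde y)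
  let L : Matrix (Fin N) (Fin N) (PowerSeries ℂ) := f.mapMatrix (Matrix.vandermonde y)⁻¹
  have hVL : V * L = 1 := by
    rw [← map_mul, Matrix.mul_nonsing_inv _ hV, map_one]
  let Δ : Matrix (Fin N) (Fin N) (PowerSeries ℂ) :=
    Matrix.diagonal fun a => f (w (m + a)) * PowerSeries.X ^ (m + (a : ℕ))
  -- The entries of `Δ` have order at most `m + N - 1`, so `X ^ (m + N)` is `Δ` times something
  -- still divisible by `X`, namely `X • Δ'`.
  let Δ' : Matrix (Fin N) (Fin N) (PowerSeries ℂ) :=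
    Matrix.diagonal fun a => f (w (m + a))⁻¹ * PowerSeries.X ^ (N - 1 - (a : ℕ))
  let R : Matrix (Fin N) (Fin N) (PowerSeries ℂ) := Matrix.of fun j l : Fin N =>
      PowerSeries.mk fun k => w (k + (m + N)) * x (k + (m + N)) ^ ((j : ℕ) + (l : ℕ))
  -- Terms with `k < m` vanish, the next `N` give a product of Vandermonde matrices around a
  -- diagonal one, and the tail is divisible by `X ^ (m + N)`.
  have hdec : S = V.transpose * Δ * V + (PowerSeries.X ^ (m + N) : PowerSeries ℂ) • R := by
    ext j l k
    have h1 : (V.transpose * Δ * V) j l = ∑ a : Fin N,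
        f (w (m + a) * x (m + a) ^ ((j : ℕ) + (l : ℕ))) * PowerSeries.X ^ (m + (a : ℕ)) := by
      rw [Matrix.mul_apply]
      refine Finset.sum_congr rfl fun a _ => ?_
      simp only [V, Δ, y, Matrix.mul_diagonal, Matrix.transpose_apply, RingHom.mapMatrix_apply,
        Matrix.map_apply, Matrix.vandermonde_apply, map_mul, map_pow, pow_add]
      ring
    rw [Matrix.add_apply, h1, Matrix.smul_apply, smul_eq_mul, map_add, map_sum,
      PowerSeries.coeff_X_pow_mul']
    simp only [hS, R, f, Matrix.of_apply, PowerSeries.coeff_mk, PowerSeries.coeff_C_mul,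
      PowerSeries.coeff_X_pow]
    rcases lt_or_ge k m with h | h
    · rw [hw k h, zero_mul, if_neg (by omega), Finset.sum_eq_zero, add_zero]
      intro a _
      rw [if_neg (by omega), mul_zero]
    · rcases lt_or_ge k (m + N) with h' | h'
      · rw [if_neg (by omega), Finset.sum_eq_single (⟨k - m, by omega⟩ : Fin N)]
        · simp [show m + (k - m) = k by omega]
        · intro a _ ha
          rw [if_neg, mul_zero]
          intro hk
          exact ha (Fin.ext (by simp [hk]))
        · simp
      · rw [if_pos h', Finset.sum_eq_zero, zero_add, Nat.sub_add_cancel h']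
        intro a _
        rw [if_neg (by omega), mul_zero]
  have hΔ : Δ * ((PowerSeries.X : PowerSeries ℂ) • Δ') =
      (PowerSeries.X ^ (m + N) : PowerSeries ℂ) • (1 : Matrix (Fin N) (Fin N) (PowerSeries ℂ)) := by
    rw [Matrix.mul_smul, Matrix.diagonal_mul_diagonal, ← Matrix.diagonal_one, ← Matrix.diagonal_smul,
      ← Matrix.diagonal_smul]
    congr 1
    ext1 a
    have hwa : f (w (m + a)) * f (w (m + a))⁻¹ = 1 := by
      rw [← map_mul, mul_inv_cancel₀ (hw' _ (by omega)), map_one]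
    have he : m + N = (m + a) + (N - 1 - a) + 1 := by omega
    simp only [Pi.smul_apply, smul_eq_mul, mul_one]
    rw [he, pow_add, pow_add, pow_one]
    linear_combination (PowerSeries.X * PowerSeries.X ^ (m + (a : ℕ)) *
      PowerSeries.X ^ (N - 1 - (a : ℕ))) * hwa
  -- Removing the Vandermonde factors leaves `Δ` times a matrix congruent to 1 modulo `X`, whose
  -- determinant has constant term 1.
  have hfac : L.transpose * S * L =
      Δ * (1 + (PowerSeries.X : PowerSeries ℂ) • (Δ' * (L.transpose * R * L))) := by
    have hLV : L.transpose * V.transpose = 1 := by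
      rw [← Matrix.transpose_mul, hVL, Matrix.transpose_one]
    have e1 : L.transpose * (V.transpose * Δ * V) * L = Δ := by
      calc _ = (L.transpose * V.transpose) * Δ * (V * L) := by simp only [Matrix.mul_assoc]
        _ = Δ := by rw [hLV, hVL, Matrix.one_mul, Matrix.mul_one]
    rw [hdec, Matrix.mul_add, Matrix.add_mul, e1, Matrix.mul_add, Matrix.mul_one,
      ← Matrix.smul_mul, ← Matrix.mul_assoc Δ, hΔ]
    simp
  intro h0
  have h1 := congrArg Matrix.det hfac
  rw [Matrix.det_mul, Matrix.det_mul, h0, mul_zero, zero_mul, Matrix.det_mul] at h1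
  have h2 : Δ.det ≠ 0 := by
    rw [Matrix.det_diagonal, Finset.prod_ne_zero_iff]
    intro a _
    refine mul_ne_zero ?_ (pow_ne_zero _ PowerSeries.X_ne_zero)
    rw [Ne, map_eq_zero_iff f PowerSeries.C_injective]
    exact hw' _ (by omega)
  have h3 := (mul_eq_zero.1 h1.symm).resolve_left h2
  have h4 := congrArg (PowerSeries.constantCoeff (R := ℂ)) h3
  rw [RingHom.map_det, map_add, map_one, map_zero] at h4
  have h5 : (PowerSeries.constantCoeff (R := ℂ)).mapMatrix
      ((PowerSeries.X : PowerSeries ℂ) • (Δ' * (L.transpose * R * L))) = 0 := by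
    ext i j
    simp
  rw [h5, add_zero, Matrix.det_one] at h4
  exact one_ne_zero h4

theorem one_sub_mul_geom (a : ℂ) :
    ((1 - C a * X : ℂ[X]) : PowerSeries ℂ) * PowerSeries.mk (fun k => a ^ k) = 1 := by
  ext k
  cases k with
  | zero => simp [sub_mul, mul_assoc]
  | succ k =>
    simp [sub_mul, mul_assoc, PowerSeries.coeff_succ_X_mul, PowerSeries.coeff_one, pow_succ']

/-- The Hankel determinants of the moments `qⁱ / (1 - t q²ⁱ)` against a polynomial `Q` vanish
only for finitely many `t`. -/
theorem finite_setOf_det_hankel_eq_zero {q : ℂ}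
    (hx : Function.Injective fun k : ℕ => q ^ (2 * k + 1)) {Q : ℂ[X]} {m : ℕ}
    (hQ : ∀ k < m, Q.eval (q ^ (2 * k + 1)) = 0)
    (hQ' : ∀ k, m ≤ k → Q.eval (q ^ (2 * k + 1)) ≠ 0) (N : ℕ) :
    {t : ℂ | (∀ i : ℕ, 1 - q ^ (2 * i) * t ≠ 0) ∧
      (Matrix.of fun j l : Fin N => ∑ i ∈ Finset.range (Q.natDegree + 1),
        Q.coeff i * (q ^ (i + (j + l : ℕ)) * (1 - q ^ (2 * (i + (j + l : ℕ))) * t)⁻¹)).det = 0}.Finite := by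
  -- `B` exceeds every index `i + j + l` that occurs, so `D` is a common denominator of all entries
  -- and `G` is the matrix cleared of denominators.
  let B := Q.natDegree + 1 + 2 * N
  let F : ℕ → ℂ[X] := fun i => 1 - C (q ^ (2 * i)) * X
  let D : ℂ[X] := ∏ i ∈ Finset.range B, F i
  let E : ℕ → ℂ[X] := fun i => ∏ i' ∈ (Finset.range B).erase i, F i'
  have hE : ∀ i < B, D = E i * F i := fun i hi =>
    (Finset.prod_erase_mul _ _ (Finset.mem_range.2 hi)).symm
  let G : Matrix (Fin N) (Fin N) ℂ[X] := Matrix.of fun j l =>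
    ∑ i ∈ Finset.range (Q.natDegree + 1), C (Q.coeff i * q ^ (i + (j + l : ℕ))) * E (i + (j + l : ℕ))
  have hGa : ∀ j l, G j l = ∑ i ∈ Finset.range (Q.natDegree + 1),
    C (Q.coeff i * q ^ (i + (j + l : ℕ))) * E (i + (j + l : ℕ)) := fun _ _ => rfl
  have hB : ∀ i ∈ Finset.range (Q.natDegree + 1), ∀ j l : Fin N, i + (j + l : ℕ) < B := by
    intro i hi j l
    have := Finset.mem_range.1 hi
    simp only [B]
    omega
  have hG : G.det ≠ 0 := by
    intro h0
    have h1 := congrArg (Polynomial.coeToPowerSeries.ringHom (R := ℂ)) h0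
    rw [RingHom.map_det, map_zero] at h1
    have h2 : (Polynomial.coeToPowerSeries.ringHom (R := ℂ)).mapMatrix G =
        (D : PowerSeries ℂ) • Matrix.of fun j l : Fin N => PowerSeries.mk fun k =>
          Q.eval (q ^ (2 * k + 1)) * (q ^ (2 * k + 1)) ^ ((j : ℕ) + (l : ℕ)) := by
      refine Matrix.ext fun j l => ?_
      -- Expanding each `1 / (1 - q^{2r} t)` geometrically and summing over the coefficients of `Q`
      -- evaluates `Q` at the node `q^{2k+1}`.
      have h3 : (PowerSeries.mk fun k =>
          Q.eval (q ^ (2 * k + 1)) * (q ^ (2 * k + 1)) ^ ((j : ℕ) + (l : ℕ))) =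
          ∑ i ∈ Finset.range (Q.natDegree + 1), PowerSeries.C (Q.coeff i * q ^ (i + (j + l : ℕ))) *
            PowerSeries.mk fun k => (q ^ (2 * (i + (j + l : ℕ)))) ^ k := by
        ext k
        rw [PowerSeries.coeff_mk, map_sum, Polynomial.eval_eq_sum_range, Finset.sum_mul]
        refine Finset.sum_congr rfl fun i _ => ?_
        rw [PowerSeries.coeff_C_mul, PowerSeries.coeff_mk]
        ring
      rw [Matrix.smul_apply, Matrix.of_apply, h3, smul_eq_mul, Finset.mul_sum,
        RingHom.mapMatrix_apply, Matrix.map_apply, hGa, map_sum]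
      refine Finset.sum_congr rfl fun i hi => ?_
      have h4 := one_sub_mul_geom (q ^ (2 * (i + (j + l : ℕ))))
      rw [hE _ (hB i hi j l), map_mul]
      simp only [Polynomial.coeToPowerSeries.ringHom_apply, Polynomial.coe_mul, F,
        Polynomial.coe_C]
      linear_combination (-(PowerSeries.C (Q.coeff i * q ^ (i + (j + l : ℕ))) *
        (E (i + (j + l : ℕ)) : PowerSeries ℂ))) * h4
    rw [h2, Matrix.det_smul] at h1
    refine mul_ne_zero (pow_ne_zero _ ?_) (det_hankel_powerSeries_ne_zero hx hQ hQ' N) h1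
    rw [Ne, Polynomial.coe_eq_zero_iff, Finset.prod_eq_zero_iff]
    rintro ⟨i, -, hi⟩
    have := congrArg (Polynomial.eval 0) hi
    simp [F] at this
  refine (G.det.roots.toFinset.finite_toSet).subset ?_
  rintro t ⟨ht, h0⟩
  rw [Finset.mem_coe, Multiset.mem_toFinset, Polynomial.mem_roots hG, Polynomial.IsRoot.def,
    ← Polynomial.coe_evalRingHom, RingHom.map_det]
  have h2 : (Polynomial.evalRingHom t).mapMatrix G = (D.eval t) •
      (Matrix.of fun j l : Fin N => ∑ i ∈ Finset.range (Q.natDegree + 1),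
        Q.coeff i * (q ^ (i + (j + l : ℕ)) * (1 - q ^ (2 * (i + (j + l : ℕ))) * t)⁻¹)) := by
    refine Matrix.ext fun j l => ?_
    rw [Matrix.smul_apply, Matrix.of_apply, smul_eq_mul, Finset.mul_sum,
        RingHom.mapMatrix_apply, Matrix.map_apply, hGa, map_sum]
    refine Finset.sum_congr rfl fun i hi => ?_
    have h4 := mul_inv_cancel₀ (ht (i + (j + l : ℕ)))
    rw [hE _ (hB i hi j l), map_mul]
    simp only [Polynomial.coe_evalRingHom, F, eval_mul, eval_sub, eval_C, eval_X, eval_one]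
    linear_combination (-(Q.coeff i * q ^ (i + (j + l : ℕ)) * (E (i + (j + l : ℕ))).eval t)) * h4
  rw [h2, Matrix.det_smul, h0, mul_zero]

/-! ### The moment recurrence and its Hankel matrices -/

/-- The factor `q⁻ⁱ - t qⁱ` relating the moments of a twisted trace to a linear recurrence. -/
noncomputable def momentFactor (q t : ℂ) (i : ℕ) : ℂ := (q ^ i)⁻¹ - t * q ^ i

/-- The linear recurrence satisfied by the moments `m i = T (Z ^ i)` of a twisted trace. -/
def IsMomentSequence (q t : ℂ) {n : ℕ} (c : Fin (n + 1) → ℂ) (m : ℕ → ℂ) : Prop :=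
  ∀ j : ℕ, ∑ i : Fin (n + 1), c i * (momentFactor q t (i + j) * m (i + j)) = 0

/-- The solution of the recurrence `IsMomentSequence` with given coefficients `x (inl i)` and
initial values `x (inr i)`. -/
noncomputable def moments (q t : ℂ) {n : ℕ} (x : Fin (n + 1) ⊕ Fin n → ℂ) (k : ℕ) : ℂ :=
  if h : k < n then x (.inr ⟨k, h⟩)
  else -(x (.inl (Fin.last n)))⁻¹ * ((momentFactor q t k)⁻¹ *
    ∑ i : Fin n, x (.inl i.castSucc) *
      (momentFactor q t (i + (k - n)) * moments q t x (i + (k - n))))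
termination_by k
decreasing_by have := i.2; omega

theorem isMomentSequence_iff {q t : ℂ} (hd : ∀ i, momentFactor q t i ≠ 0) {n : ℕ}
    {x : Fin (n + 1) ⊕ Fin n → ℂ} (hx : x (.inl (Fin.last n)) ≠ 0) {m : ℕ → ℂ} :
    (IsMomentSequence q t (fun i => x (.inl i)) m ∧ ∀ i : Fin n, m i = x (.inr i)) ↔
      m = moments q t x := by
  constructor
  · rintro ⟨h, h'⟩
    funext k
    induction k using Nat.strong_induction_on with
    | _ k ih =>
      rw [moments]
      split_ifs with hk
      · exact h' ⟨k, hk⟩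
      -- The recurrence with `j = k - n` has top index `k`, so it gives `m k` in terms of earlier
      -- moments.
      · have h1 := h (k - n)
        rw [Fin.sum_univ_castSucc] at h1
        simp only [Fin.val_last, Fin.val_castSucc, show n + (k - n) = k by omega] at h1
        have h2 : ∀ i : Fin n, m (i + (k - n)) = moments q t x (i + (k - n)) :=
          fun i => ih _ (by have := i.2; omega)
        simp only [h2] at h1
        generalize (∑ i : Fin n, x (.inl i.castSucc) * (momentFactor q t (i + (k - n)) *
          moments q t x (i + (k - n)))) = S at h1 ⊢
        have := hd k
        field_simp
        linear_combination h1
  · rintro rfl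
    refine ⟨fun j => ?_, fun i => by rw [moments, dif_pos i.2]⟩
    rw [Fin.sum_univ_castSucc]
    simp only [Fin.val_last, Fin.val_castSucc]
    rw [moments.eq_1 q t x (n + j), dif_neg (by omega), Nat.add_sub_cancel_left]
    have := hd (n + j)
    field_simp
    ring

/-- Extension of a moment sequence to a linear functional on polynomials. -/
noncomputable def momentFunctional (m : ℕ → ℂ) : ℂ[X] →ₗ[ℂ] ℂ :=
  Polynomial.lsum fun i => m i • LinearMap.id

theorem momentFunctional_monomial (m : ℕ → ℂ) (i : ℕ) (a : ℂ) :
    momentFunctional m (monomial i a) = a * m i := by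
  simp [momentFunctional, Polynomial.lsum_apply, Polynomial.sum_monomial_index, mul_comm]

theorem momentFunctional_mul_X_pow (m : ℕ → ℂ) (Q : ℂ[X]) {B : ℕ} (hB : Q.natDegree < B) (r : ℕ) :
    momentFunctional m (Q * X ^ r) = ∑ i ∈ Finset.range B, Q.coeff i * m (i + r) := by
  conv_lhs => rw [Q.as_sum_range' B hB, Finset.sum_mul, map_sum]
  refine Finset.sum_congr rfl fun i _ => ?_
  rw [monomial_mul_X_pow, momentFunctional_monomial]

/-- The polynomial `∏_{s < M} P(q^{-1-2s} x)`, so that `u ^ M * v ^ M` is its value at `Z`. -/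
noncomputable def shiftProd (q : ℂ) (P : ℂ[X]) (M : ℕ) : ℂ[X] :=
  ∏ s ∈ Finset.range M, P.comp (C (q⁻¹ * ((q ^ 2)⁻¹) ^ s) * X)

/-- The Gram matrix of the trace form between the pieces of weights `M` and `-M`, up to scaling
of its rows. -/
noncomputable def hankel (q t : ℂ) {n : ℕ} (M N : ℕ) (x : Fin (n + 1) ⊕ Fin n → ℂ) :
    Matrix (Fin N) (Fin N) ℂ :=
  Matrix.of fun j l => momentFunctional (moments q t x)
    (shiftProd q (param fun i => x (.inl i)) M * X ^ ((j : ℕ) + (l : ℕ)))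

/-- In this form the inverse factors are the moments of `finite_setOf_det_hankel_eq_zero`. -/
theorem momentFactor_inv {q : ℂ} (hq : q ≠ 0) (t : ℂ) (i : ℕ) :
    (momentFactor q t i)⁻¹ = q ^ i * (1 - q ^ (2 * i) * t)⁻¹ := by
  have : momentFactor q t i = (q ^ i)⁻¹ * (1 - q ^ (2 * i) * t) := by
    have := pow_ne_zero i hq
    rw [momentFactor, mul_comm 2 i, pow_mul]
    field_simp
  rw [this, mul_inv, inv_inv]

theorem eval_param {n : ℕ} (c : Fin (n + 1) → ℂ) (y : ℂ) :
    (param c).eval y = ∑ i : Fin (n + 1), c i * y ^ (i : ℕ) := by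
  simp [param, eval_finsetSum]

theorem pow_injective_of_norm_ne_one {q : ℂ} (hq₀ : q ≠ 0) (hq : ‖q‖ ≠ 1) :
    Function.Injective fun k : ℕ => q ^ k := fun a b h => by
  have h' := congrArg norm h
  simp only [norm_pow] at h'
  exact pow_right_injective₀ (norm_pos_iff.2 hq₀) hq h'

/-- For all but countably many `t` there is a parameter for which all Hankel determinants are
nonzero. -/
theorem exists_countable_hankel_det_ne_zero {n : ℕ} (hn : 0 < n) {q : ℂ} (hq₀ : q ≠ 0)
    (hq : ‖q‖ ≠ 1) : ∃ Z : Set ℂ, Z.Countable ∧ ∀ t ∉ Z, (∀ i, momentFactor q t i ≠ 0) →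
      ∃ x : Fin (n + 1) ⊕ Fin n → ℂ, x (.inl (Fin.last n)) ≠ 0 ∧
        ∀ M N, (hankel q t M N x).det ≠ 0 := by
  obtain ⟨n, rfl⟩ := Nat.exists_eq_succ_of_ne_zero hn.ne'
  have hinj := pow_injective_of_norm_ne_one hq₀ hq
  -- With `n + 1` for the original `n`, this is `x^n (x - 1)`. Its coefficients sum to 0, so the
  -- inverse moment factors solve the recurrence; its only nonzero root is 1, so `shiftProd`
  -- vanishes at `q^{2k+1}` exactly for `k < M`.
  let c : Fin (n + 2) → ℂ := Fin.snoc (Fin.snoc (0 : Fin n → ℂ) (-1 : ℂ) : Fin (n + 1) → ℂ) (1 : ℂ)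
  have hc : ∀ f : ℕ → ℂ, ∑ i : Fin (n + 2), c i * f i = f (n + 1) - f n := by
    intro f
    simp [c, Fin.sum_univ_castSucc]
    ring
  have hP : ∀ y, (param c).eval y = y ^ n * (y - 1) := by
    intro y
    rw [eval_param, hc fun i => y ^ i]
    ring
  have hQe : ∀ M k, (shiftProd q (param c) M).eval (q ^ (2 * k + 1)) =
      ∏ s ∈ Finset.range M, (param c).eval (q⁻¹ * ((q ^ 2)⁻¹) ^ s * q ^ (2 * k + 1)) := by
    intro M k
    simp [shiftProd, eval_prod]
  have hQ : ∀ M, ∀ k < M, (shiftProd q (param c) M).eval (q ^ (2 * k + 1)) = 0 := by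
    intro M k hk
    rw [hQe]
    refine Finset.prod_eq_zero (Finset.mem_range.2 hk) ?_
    have : q⁻¹ * ((q ^ 2)⁻¹) ^ k * q ^ (2 * k + 1) = 1 := by
      rw [inv_pow, ← pow_mul, pow_succ]
      field_simp
    rw [this, hP]
    simp
  have hQ' : ∀ M k, M ≤ k → (shiftProd q (param c) M).eval (q ^ (2 * k + 1)) ≠ 0 := by
    intro M k hk
    rw [hQe, Finset.prod_ne_zero_iff]
    intro s hs
    have hs := Finset.mem_range.1 hs
    have : q⁻¹ * ((q ^ 2)⁻¹) ^ s * q ^ (2 * k + 1) = q ^ (2 * (k - s)) := by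
      rw [inv_pow, ← pow_mul, show 2 * k + 1 = 2 * s + 2 * (k - s) + 1 by omega, pow_succ, pow_add]
      field_simp
    rw [this, hP]
    refine mul_ne_zero (pow_ne_zero _ (pow_ne_zero _ hq₀)) (sub_ne_zero.2 fun h => ?_)
    have := hinj (h.trans (pow_zero q).symm)
    omega
  have hx : Function.Injective fun k : ℕ => q ^ (2 * k + 1) := fun a b h => by
    have := hinj h
    omega
  refine ⟨⋃ p : ℕ × ℕ, _, Set.countable_iUnion fun p =>
    (finite_setOf_det_hankel_eq_zero hx (hQ p.1) (hQ' p.1) p.2).countable, ?_⟩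
  intro t ht hd
  let x : Fin (n + 2) ⊕ Fin (n + 1) → ℂ := Sum.elim c fun i => (momentFactor q t i)⁻¹
  have hx1 : x (.inl (Fin.last (n + 1))) = 1 := by simp [x, c]
  have hx1' : x (.inl (Fin.last (n + 1))) ≠ 0 := by rw [hx1]; exact one_ne_zero
  have hm : (fun i => (momentFactor q t i)⁻¹) = moments q t x := by
    rw [← isMomentSequence_iff hd hx1']
    refine ⟨fun j => ?_, fun i => rfl⟩
    simp only [mul_inv_cancel₀ (hd _)]
    have := hc fun _ => 1
    simpa [x] using this
  refine ⟨x, hx1', fun M N h0 => ht (Set.mem_iUnion.2 ⟨(M, N), fun i h => ?_, ?_⟩)⟩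
  · have := momentFactor_inv hq₀ t i
    rw [h, inv_zero, mul_zero] at this
    exact inv_ne_zero (hd i) this
  · rw [← h0]
    congr 1
    refine Matrix.ext fun j l => ?_
    simp only [hankel, Matrix.of_apply, ← hm]
    rw [momentFunctional_mul_X_pow _ _ (Nat.lt_succ_self _)]
    simp only [momentFactor_inv hq₀]
    rfl

/-! ### Rational dependence on the parameters and generic nonvanishing -/

/-- The functions that are regular where the coordinate `s` does not vanish. -/
def regularFunctions {σ : Type} (s : σ) : Subalgebra ℂ ((σ → ℂ) → ℂ) where
  carrier := {φ | ∃ (f : MvPolynomial σ ℂ) (e : ℕ),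
    ∀ x : σ → ℂ, x s ≠ 0 → φ x * x s ^ e = MvPolynomial.eval x f}
  mul_mem' := by
    rintro φ ψ ⟨f, e, hf⟩ ⟨f', e', hf'⟩
    refine ⟨f * f', e + e', fun x hx => ?_⟩
    rw [map_mul, ← hf x hx, ← hf' x hx, Pi.mul_apply]
    ring
  add_mem' := by
    rintro φ ψ ⟨f, e, hf⟩ ⟨f', e', hf'⟩
    refine ⟨f * MvPolynomial.X s ^ e' + f' * MvPolynomial.X s ^ e, e + e', fun x hx => ?_⟩
    simp only [map_mul, map_add, map_pow, MvPolynomial.eval_X, ← hf x hx, ← hf' x hx, Pi.add_apply]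
    ring
  algebraMap_mem' a := ⟨MvPolynomial.C a, 0, fun x _ => by simp⟩

theorem const_mem_regularFunctions {σ : Type} (s : σ) (a : ℂ) :
    (fun _ => a) ∈ regularFunctions s :=
  (regularFunctions s).algebraMap_mem a

theorem coord_mem_regularFunctions {σ : Type} (s i : σ) : (fun x => x i) ∈ regularFunctions s :=
  ⟨MvPolynomial.X i, 0, fun x _ => by simp⟩

theorem inv_coord_mem_regularFunctions {σ : Type} (s : σ) :
    (fun x => (x s)⁻¹) ∈ regularFunctions s :=
  ⟨1, 1, fun x hx => by simp [hx]⟩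

theorem sum_mem_regularFunctions {σ ι : Type} {s : σ} {A : Finset ι} {φ : ι → (σ → ℂ) → ℂ}
    (h : ∀ i ∈ A, φ i ∈ regularFunctions s) : (fun x => ∑ i ∈ A, φ i x) ∈ regularFunctions s := by
  have := Subalgebra.sum_mem _ h
  rwa [Finset.sum_fn] at this

theorem prod_mem_regularFunctions {σ ι : Type} {s : σ} {A : Finset ι} {φ : ι → (σ → ℂ) → ℂ}
    (h : ∀ i ∈ A, φ i ∈ regularFunctions s) : (fun x => ∏ i ∈ A, φ i x) ∈ regularFunctions s := by
  have := Subalgebra.prod_mem _ h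
  rwa [Finset.prod_fn] at this

theorem exists_hypersurface_of_mem_regularFunctions {σ : Type} {s : σ} {φ : (σ → ℂ) → ℂ}
    (hφ : φ ∈ regularFunctions s) {x₀ : σ → ℂ} (hs : x₀ s ≠ 0) (h₀ : φ x₀ ≠ 0) :
    ∃ f : MvPolynomial σ ℂ, f.totalDegree ≠ 0 ∧
      ∀ x, MvPolynomial.eval x f ≠ 0 → x s ≠ 0 ∧ φ x ≠ 0 := by
  obtain ⟨f, e, hf⟩ := hφ
  have hf0 : f ≠ 0 := by
    rintro rfl
    have := hf x₀ hs
    rw [map_zero] at this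
    exact mul_ne_zero h₀ (pow_ne_zero _ hs) this
  -- The factor `X s` excludes the locus where the coordinate vanishes and makes the polynomial
  -- nonconstant even if `f` is constant.
  refine ⟨MvPolynomial.X s * f, ?_, fun x hx => ?_⟩
  · rw [MvPolynomial.totalDegree_mul_of_isDomain (MvPolynomial.X_ne_zero s) hf0,
      MvPolynomial.totalDegree_X]
    omega
  · rw [map_mul, MvPolynomial.eval_X] at hx
    have hxs := left_ne_zero_of_mul hx
    refine ⟨hxs, fun h => right_ne_zero_of_mul hx ?_⟩
    rw [← hf x hxs, h, zero_mul]

/-- The recursion divides only by the leading coefficient of the parameter and by factors that do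
not depend on the point. -/
theorem moments_mem_regularFunctions (q t : ℂ) {n : ℕ} (k : ℕ) :
    (fun x : Fin (n + 1) ⊕ Fin n → ℂ => moments q t x k) ∈
      regularFunctions (.inl (Fin.last n)) := by
  induction k using Nat.strong_induction_on with
  | _ k ih =>
    by_cases hk : k < n
    · have : (fun x : Fin (n + 1) ⊕ Fin n → ℂ => moments q t x k) = fun x => x (.inr ⟨k, hk⟩) := by
        funext x
        rw [moments, dif_pos hk]
      rw [this]
      exact coord_mem_regularFunctions _ _
    · have : (fun x : Fin (n + 1) ⊕ Fin n → ℂ => moments q t x k) =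
          fun x => -(x (.inl (Fin.last n)))⁻¹ * ((momentFactor q t k)⁻¹ *
            ∑ i : Fin n, x (.inl i.castSucc) *
              (momentFactor q t (i + (k - n)) * moments q t x (i + (k - n)))) := by
        funext x
        rw [moments, dif_neg hk]
      rw [this]
      refine mul_mem (neg_mem (inv_coord_mem_regularFunctions _))
        (mul_mem (const_mem_regularFunctions _ _) (sum_mem_regularFunctions fun i _ =>
          mul_mem (coord_mem_regularFunctions _ _)
            (mul_mem (const_mem_regularFunctions _ _) (ih _ (by have := i.2; omega)))))

theorem coeff_param {n : ℕ} (c : Fin (n + 1) → ℂ) (k : ℕ) :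
    (param c).coeff k = if h : k < n + 1 then c ⟨k, h⟩ else 0 := by
  simp only [param, finsetSum_coeff, coeff_C_mul, coeff_X_pow, mul_ite, mul_one, mul_zero]
  split_ifs with h
  · rw [Finset.sum_eq_single ⟨k, h⟩]
    · simp
    · intro i _ hi
      exact if_neg fun h => hi (Fin.ext h.symm)
    · simp
  · refine Finset.sum_eq_zero fun i _ => if_neg ?_
    have := i.2
    omega

theorem natDegree_param_le {n : ℕ} (c : Fin (n + 1) → ℂ) : (param c).natDegree ≤ n :=
  natDegree_le_iff_coeff_eq_zero.2 fun k hk => by rw [coeff_param, dif_neg (by omega)]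

theorem shiftProd_succ' (q : ℂ) (P : ℂ[X]) (M : ℕ) :
    shiftProd q P (M + 1) = shiftProd q P M * P.comp (C (q⁻¹ * ((q ^ 2)⁻¹) ^ M) * X) :=
  Finset.prod_range_succ _ _

theorem natDegree_shiftProd_le (q : ℂ) (P : ℂ[X]) (M : ℕ) :
    (shiftProd q P M).natDegree ≤ M * P.natDegree := by
  induction M with
  | zero => simp [shiftProd]
  | succ M ih =>
    rw [shiftProd_succ', add_mul, one_mul]
    refine natDegree_mul_le.trans (add_le_add ih ?_)
    refine natDegree_comp_le.trans ?_
    exact (Nat.mul_le_mul_left _ ((natDegree_C_mul_le _ _).trans natDegree_X_le)).trans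
      (Nat.mul_one _).le

theorem coeff_shiftProd_mem_regularFunctions (q : ℂ) {n : ℕ} (M k : ℕ) :
    (fun x : Fin (n + 1) ⊕ Fin n → ℂ => (shiftProd q (param fun i => x (.inl i)) M).coeff k) ∈
      regularFunctions (.inl (Fin.last n)) := by
  induction M generalizing k with
  | zero =>
    simp only [shiftProd, Finset.range_zero, Finset.prod_empty]
    exact const_mem_regularFunctions _ _
  | succ M ih =>
    simp only [shiftProd_succ', coeff_mul, comp_C_mul_X_coeff]
    refine sum_mem_regularFunctions fun p _ => mul_mem (ih _)
      (mul_mem ?_ (const_mem_regularFunctions _ _))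
    simp only [coeff_param]
    split_ifs
    · exact coord_mem_regularFunctions _ _
    · exact const_mem_regularFunctions _ _

theorem det_hankel_mem_regularFunctions (q t : ℂ) {n : ℕ} (M N : ℕ) :
    (fun x : Fin (n + 1) ⊕ Fin n → ℂ => (hankel q t M N x).det) ∈
      regularFunctions (.inl (Fin.last n)) := by
  have hentry : ∀ j l, (fun x : Fin (n + 1) ⊕ Fin n → ℂ => hankel q t M N x j l) ∈
      regularFunctions (.inl (Fin.last n)) := by
    intro j l
    have : (fun x : Fin (n + 1) ⊕ Fin n → ℂ => hankel q t M N x j l) = fun x =>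
        ∑ i ∈ Finset.range (M * n + 1), (shiftProd q (param fun i => x (.inl i)) M).coeff i *
          moments q t x (i + ((j : ℕ) + (l : ℕ))) := by
      funext x
      refine momentFunctional_mul_X_pow _ _ (Nat.lt_succ_of_le ?_) _
      exact (natDegree_shiftProd_le _ _ _).trans (Nat.mul_le_mul_left _ (natDegree_param_le _))
    rw [this]
    exact sum_mem_regularFunctions fun i _ =>
      mul_mem (coeff_shiftProd_mem_regularFunctions _ _ _) (moments_mem_regularFunctions _ _ _)
  simp only [Matrix.det_apply']
  exact sum_mem_regularFunctions fun p _ =>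
    mul_mem (const_mem_regularFunctions _ _) (prod_mem_regularFunctions fun i _ => hentry _ _)

/-! ### Weight monomials and commutation relations -/

section Weight

variable {R : Type*} [Ring R]

/-- The monomial in `u` and `v` of weight `e`: `u ^ e` if `e ≥ 0` and `v ^ (-e)` if `e ≤ 0`. -/
def wt (u v : R) (e : ℤ) : R := u ^ e.toNat * v ^ (-e).toNat

theorem wt_natCast (u v : R) (m : ℕ) : wt u v m = u ^ m := by simp [wt]

theorem wt_neg_natCast (u v : R) (m : ℕ) : wt u v (-(m : ℤ)) = v ^ m := by simp [wt]

theorem wt_zero (u v : R) : wt u v 0 = 1 := by simp [wt]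

theorem wt_swap (u v : R) (e : ℤ) : wt v u e = wt u v (-e) := by
  obtain ⟨m, rfl | rfl⟩ := e.eq_nat_or_neg
  · rw [wt_natCast, wt_neg_natCast]
  · rw [neg_neg, wt_natCast, wt_neg_natCast]

end Weight

section Abstract

variable {R : Type*} [Ring R] [Algebra ℂ R]

theorem mul_pow_of_mul_eq_smul {a : ℂ} {z w : R} (h : z * w = a • (w * z)) (m : ℕ) :
    z * w ^ m = a ^ m • (w ^ m * z) := by
  induction m with
  | zero => simp
  | succ m ih =>
    rw [pow_succ, ← mul_assoc, ih, smul_mul_assoc, mul_assoc, h, mul_smul_comm, smul_smul,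
      ← pow_succ, mul_assoc]

theorem pow_mul_of_mul_eq_smul {a : ℂ} {z w : R} (h : z * w = a • (w * z)) (j : ℕ) :
    z ^ j * w = a ^ j • (w * z ^ j) := by
  induction j with
  | zero => simp
  | succ j ih =>
    rw [pow_succ, mul_assoc, h, mul_smul_comm, ← mul_assoc, ih, smul_mul_assoc, smul_smul,
      ← pow_succ', mul_assoc]

theorem aeval_mul_of_mul_eq_smul {a : ℂ} {z w : R} (h : z * w = a • (w * z)) (f : ℂ[X]) :
    aeval z f * w = w * aeval z (f.comp (C a * X)) := by
  induction f using Polynomial.induction_on' with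
  | add f g hf hg => rw [map_add, add_mul, hf, hg, add_comp, map_add, mul_add]
  | monomial i b =>
    have h1 : aeval z ((monomial i b).comp (C a * X)) = b • a ^ i • z ^ i := by
      simp [monomial_comp, mul_pow, Algebra.smul_def]
    rw [aeval_monomial, mul_assoc, pow_mul_of_mul_eq_smul h, h1, ← Algebra.smul_def,
      mul_smul_comm, mul_smul_comm]

theorem natDegree_comp_C_mul_X_le (f : ℂ[X]) (a : ℂ) : (f.comp (C a * X)).natDegree ≤ f.natDegree :=
  natDegree_comp_le.trans <| (Nat.mul_le_mul_left _
    ((natDegree_C_mul_le _ _).trans natDegree_X_le)).trans (Nat.mul_one _).le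

/-- The relations of the `q`-Weyl algebra that do not involve `Z⁻¹`. -/
structure WeylRelations (q : ℂ) (P : ℂ[X]) (u v z : R) : Prop where
  zu : z * u = q ^ 2 • (u * z)
  zv : z * v = (q ^ 2)⁻¹ • (v * z)
  uv : u * v = aeval z (P.comp (C q⁻¹ * X))
  vu : v * u = aeval z (P.comp (C q * X))

/-- The relations are symmetric under exchanging `u` and `v` and inverting `q`; statements about `v`
then follow from those about `u`. -/
theorem WeylRelations.symm {q : ℂ} {P : ℂ[X]} {u v z : R} (h : WeylRelations q P u v z) :
    WeylRelations q⁻¹ P v u z where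
  zu := by rw [inv_pow]; exact h.zv
  zv := by rw [inv_pow, inv_inv]; exact h.zu
  uv := by rw [inv_inv]; exact h.vu
  vu := h.uv

namespace WeylRelations

variable {q : ℂ} {P : ℂ[X]} {u v z : R}

theorem z_mul_wt (h : WeylRelations q P u v z) (e : ℤ) :
    z * wt u v e = (q ^ 2) ^ e • (wt u v e * z) := by
  obtain ⟨m, rfl | rfl⟩ := e.eq_nat_or_neg
  · rw [wt_natCast, mul_pow_of_mul_eq_smul h.zu, zpow_natCast]
  · rw [wt_neg_natCast, mul_pow_of_mul_eq_smul h.zv, zpow_neg, zpow_natCast, inv_pow]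

theorem u_mul_wt (h : WeylRelations q P u v z) {n : ℕ} (hP : P.natDegree ≤ n) (e : ℤ) :
    ∃ f : ℂ[X], n * (e + 1).natAbs + 2 * f.natDegree ≤ n * e.natAbs + n ∧
      u * wt u v e = wt u v (e + 1) * aeval z f := by
  rcases le_or_gt 0 e with he | he
  · lift e to ℕ using he
    refine ⟨1, ?_, ?_⟩
    · rw [natDegree_one, ← Nat.cast_succ, Int.natAbs_natCast, Int.natAbs_natCast, Nat.mul_succ]
      omega
    · rw [map_one, mul_one, ← Nat.cast_succ, wt_natCast, wt_natCast, pow_succ']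
  · obtain ⟨m, rfl⟩ : ∃ m : ℕ, e = -((m + 1 : ℕ) : ℤ) := ⟨(-e).toNat - 1, by omega⟩
    have e1 : -((m + 1 : ℕ) : ℤ) + 1 = -(m : ℤ) := by push_cast; ring
    have h1 := aeval_mul_of_mul_eq_smul (mul_pow_of_mul_eq_smul h.zv m) (P.comp (C q⁻¹ * X))
    refine ⟨(P.comp (C q⁻¹ * X)).comp (C (((q ^ 2)⁻¹) ^ m) * X), ?_, ?_⟩
    · rw [e1, Int.natAbs_neg, Int.natAbs_neg, Int.natAbs_natCast, Int.natAbs_natCast, Nat.mul_succ]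
      have := (natDegree_comp_C_mul_X_le (P.comp (C q⁻¹ * X)) (((q ^ 2)⁻¹) ^ m)).trans
        ((natDegree_comp_C_mul_X_le _ _).trans hP)
      omega
    · rw [e1, wt_neg_natCast, wt_neg_natCast, pow_succ', ← mul_assoc, h.uv]
      exact h1

theorem v_mul_wt (h : WeylRelations q P u v z) {n : ℕ} (hP : P.natDegree ≤ n) (e : ℤ) :
    ∃ f : ℂ[X], n * (e - 1).natAbs + 2 * f.natDegree ≤ n * e.natAbs + n ∧
      v * wt u v e = wt u v (e - 1) * aeval z f := by
  obtain ⟨f, hf, hf'⟩ := h.symm.u_mul_wt hP (-e)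
  rw [wt_swap u v, wt_swap u v, neg_neg, neg_add, neg_neg, ← sub_eq_add_neg] at hf'
  refine ⟨f, ?_, hf'⟩
  rwa [Int.natAbs_neg, ← Int.natAbs_neg (-e + 1), neg_add, neg_neg, ← sub_eq_add_neg] at hf

/-- The innermost `uv` is a polynomial in `z`; pulling it left through `u ^ M` rescales its argument
and yields the next factor of `shiftProd`. -/
theorem pow_u_mul_pow_v (hq : q ≠ 0) (h : WeylRelations q P u v z) (M : ℕ) :
    u ^ M * v ^ M = aeval z (shiftProd q P M) := by
  induction M with
  | zero => simp [shiftProd]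
  | succ M ih =>
    have h1 := aeval_mul_of_mul_eq_smul (mul_pow_of_mul_eq_smul h.zu M)
      ((P.comp (C (q⁻¹ * ((q ^ 2)⁻¹) ^ M) * X)))
    have h2 : ((P.comp (C (q⁻¹ * ((q ^ 2)⁻¹) ^ M) * X))).comp (C ((q ^ 2) ^ M) * X) =
        P.comp (C q⁻¹ * X) := by
      have : q⁻¹ * ((q ^ 2)⁻¹) ^ M * (q ^ 2) ^ M = q⁻¹ := by
        rw [mul_assoc, ← mul_pow, inv_mul_cancel₀ (pow_ne_zero 2 hq), one_pow, mul_one]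
      rw [comp_assoc, mul_comp, C_comp, X_comp, ← mul_assoc, ← C_mul, this]
    rw [h2, ← h.uv] at h1
    rw [shiftProd_succ', mul_comm, map_mul, ← ih, ← mul_assoc, h1, pow_succ, pow_succ']
    simp only [mul_assoc]

end WeylRelations

/-- The span of the monomials `wt e * z ^ j` of degree at most `k`. -/
def monomialSpan (n : ℕ) (u v z : R) (k : ℕ) : Submodule ℂ R :=
  Submodule.span ℂ {x | ∃ (e : ℤ) (j : ℕ), n * e.natAbs + 2 * j ≤ k ∧ x = wt u v e * z ^ j}

theorem wt_mul_aeval_mem_monomialSpan {n : ℕ} (u v z : R) {e : ℤ} {f : ℂ[X]} {k : ℕ}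
    (h : n * e.natAbs + 2 * f.natDegree ≤ k) : wt u v e * aeval z f ∈ monomialSpan n u v z k := by
  rw [aeval_eq_sum_range, Finset.mul_sum]
  refine Submodule.sum_mem _ fun i hi => ?_
  rw [mul_smul_comm]
  refine Submodule.smul_mem _ _ (Submodule.subset_span ⟨e, i, ?_, rfl⟩)
  have := Finset.mem_range.1 hi
  omega

theorem mul_mem_monomialSpan {n k d : ℕ} {u v z x : R}
    (hx : ∀ e j, n * e.natAbs + 2 * j ≤ k →
      x * (wt u v e * z ^ j) ∈ monomialSpan n u v z (k + d))
    {a : R} (ha : a ∈ monomialSpan n u v z k) : x * a ∈ monomialSpan n u v z (k + d) := by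
  have : monomialSpan n u v z k ≤
      (monomialSpan n u v z (k + d)).comap (LinearMap.mulLeft ℂ x) := by
    refine Submodule.span_le.2 ?_
    rintro _ ⟨e, j, hk, rfl⟩
    exact hx e j hk
  exact this ha

theorem WeylRelations.z_mul_mem {q : ℂ} {P : ℂ[X]} {u v z : R} (h : WeylRelations q P u v z)
    (n : ℕ) {k : ℕ} {a : R} (ha : a ∈ monomialSpan n u v z k) :
    z * a ∈ monomialSpan n u v z (k + 2) := by
  refine mul_mem_monomialSpan (fun e j hk => ?_) ha
  rw [← mul_assoc, h.z_mul_wt, smul_mul_assoc, mul_assoc, ← pow_succ']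
  exact Submodule.smul_mem _ _ (Submodule.subset_span ⟨e, j + 1, by omega, rfl⟩)

theorem WeylRelations.u_mul_mem {q : ℂ} {P : ℂ[X]} {u v z : R} (h : WeylRelations q P u v z)
    {n : ℕ} (hP : P.natDegree ≤ n) {k : ℕ} {a : R} (ha : a ∈ monomialSpan n u v z k) :
    u * a ∈ monomialSpan n u v z (k + n) := by
  refine mul_mem_monomialSpan (fun e j hk => ?_) ha
  obtain ⟨f, hf, hf'⟩ := h.u_mul_wt hP e
  rw [← mul_assoc, hf', mul_assoc, ← aeval_X_pow (R := ℂ) z, ← map_mul]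
  refine wt_mul_aeval_mem_monomialSpan _ _ _ ?_
  have := natDegree_mul_le (p := f) (q := X ^ j)
  rw [natDegree_X_pow] at this
  omega

theorem WeylRelations.v_mul_mem {q : ℂ} {P : ℂ[X]} {u v z : R} (h : WeylRelations q P u v z)
    {n : ℕ} (hP : P.natDegree ≤ n) {k : ℕ} {a : R} (ha : a ∈ monomialSpan n u v z k) :
    v * a ∈ monomialSpan n u v z (k + n) := by
  refine mul_mem_monomialSpan (fun e j hk => ?_) ha
  obtain ⟨f, hf, hf'⟩ := h.v_mul_wt hP e
  rw [← mul_assoc, hf', mul_assoc, ← aeval_X_pow (R := ℂ) z, ← map_mul]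
  refine wt_mul_aeval_mem_monomialSpan _ _ _ ?_
  have := natDegree_mul_le (p := f) (q := X ^ j)
  rw [natDegree_X_pow] at this
  omega

end Abstract

/-! ### Spanning monomials and the filtration of `𝒜₊` -/

section APlus

variable {q : ℂ} {P : ℂ[X]}

theorem comp_C_mul_X_eq_aeval {R : Type*} [Ring R] [Algebra ℂ R] (z : R) (a : ℂ) (P : ℂ[X]) :
    aeval z (P.comp (C a * X)) = aeval (a • z) P := by
  rw [aeval_comp, map_mul, aeval_C, aeval_X, Algebra.smul_def]

theorem weylRelations_gen (q : ℂ) (P : ℂ[X]) :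
    WeylRelations q P (gen q P .u) (gen q P .v) (gen q P .z) := by
  have hm : ∀ x, RingQuot.mkAlgHom ℂ (Rel q P) (fg x) = gen q P x := fun _ => rfl
  have hz := RingQuot.mkAlgHom_rel ℂ (Rel.zInv_z : Rel q P _ _)
  have hu := RingQuot.mkAlgHom_rel ℂ (Rel.conj_u : Rel q P _ _)
  have hv := RingQuot.mkAlgHom_rel ℂ (Rel.conj_v : Rel q P _ _)
  have huv := RingQuot.mkAlgHom_rel ℂ (Rel.u_v : Rel q P _ _)
  have hvu := RingQuot.mkAlgHom_rel ℂ (Rel.v_u : Rel q P _ _)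
  simp only [map_mul, map_one, map_smul, ← Polynomial.aeval_algHom_apply, hm] at hz hu hv huv hvu
  refine ⟨?_, ?_, ?_, ?_⟩
  · rw [← smul_mul_assoc, ← hu, mul_assoc, hz, mul_one]
  · rw [← smul_mul_assoc, ← hv, mul_assoc, hz, mul_one]
  · rw [huv, comp_C_mul_X_eq_aeval]
  · rw [hvu, comp_C_mul_X_eq_aeval]

theorem weylRelations_genPlus (q : ℂ) (P : ℂ[X]) :
    WeylRelations q P (genPlus q P .u) (genPlus q P .v) (genPlus q P .z) := by
  have h := weylRelations_gen q P
  refine ⟨Subtype.ext h.zu, Subtype.ext h.zv, Subtype.ext ?_, Subtype.ext ?_⟩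
  · rw [← Subalgebra.coe_val, ← Polynomial.aeval_algHom_apply]
    exact h.uv
  · rw [← Subalgebra.coe_val, ← Polynomial.aeval_algHom_apply]
    exact h.vu

/-- The monomial of weight `e` in the generators of `𝒜₊`. -/
noncomputable abbrev wtPlus (q : ℂ) (P : ℂ[X]) (e : ℤ) : APlus q P :=
  wt (genPlus q P .u) (genPlus q P .v) e

theorem gPlus_genPlus (t : ℂˣ) (x : GenPlus) :
    gPlus q P t (genPlus q P x) = scal t x.toGen • genPlus q P x :=
  Subtype.ext (g_gen q P t x.toGen)

theorem gPlus_wtPlus_mul (t : ℂˣ) (e : ℤ) (f : ℂ[X]) :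
    gPlus q P t (wtPlus q P e * aeval (genPlus q P .z) f) =
      (t : ℂ) ^ e • (wtPlus q P e * aeval (genPlus q P .z) f) := by
  have hz : gPlus q P t (genPlus q P .z) = genPlus q P .z := by
    rw [gPlus_genPlus, GenPlus.toGen, scal, one_smul]
  rw [map_mul, ← Polynomial.aeval_algHom_apply, hz, ← smul_mul_assoc]
  congr 1
  obtain ⟨m, rfl | rfl⟩ := e.eq_nat_or_neg
  · rw [wtPlus, wt_natCast, map_pow, gPlus_genPlus, _root_.smul_pow, GenPlus.toGen, scal, zpow_natCast]
  · rw [wtPlus, wt_neg_natCast, map_pow, gPlus_genPlus, _root_.smul_pow, GenPlus.toGen, scal, zpow_neg,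
      zpow_natCast, inv_pow]

theorem gPlus_wtPlus_mul_pow (t : ℂˣ) (e : ℤ) (j : ℕ) :
    gPlus q P t (wtPlus q P e * genPlus q P .z ^ j) =
      (t : ℂ) ^ e • (wtPlus q P e * genPlus q P .z ^ j) := by
  rw [← aeval_X_pow (R := ℂ) (genPlus q P .z)]
  exact gPlus_wtPlus_mul t e _

theorem filtration_le_monomialSpan {n : ℕ} (hP : P.natDegree ≤ n) (k : ℕ) :
    filtration q P n k ≤
      monomialSpan n (genPlus q P .u) (genPlus q P .v) (genPlus q P .z) k := by
  have h := weylRelations_genPlus q P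
  have hword : ∀ w : List GenPlus, (w.map (genPlus q P)).prod ∈
      monomialSpan n (genPlus q P .u) (genPlus q P .v) (genPlus q P .z)
        (w.map (GenPlus.deg n)).sum := by
    intro w
    induction w with
    | nil => exact Submodule.subset_span ⟨0, 0, by simp, by simp [wt_zero]⟩
    | cons x w ih =>
      rw [List.map_cons, List.map_cons, List.prod_cons, List.sum_cons, add_comm]
      cases x
      · exact h.u_mul_mem hP ih
      · exact h.v_mul_mem hP ih
      · exact h.z_mul_mem n ih
  refine Submodule.span_le.2 ?_
  rintro _ ⟨w, hw, rfl⟩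
  refine Submodule.span_mono ?_ (hword w)
  rintro _ ⟨e, j, hk, rfl⟩
  exact ⟨e, j, hk.trans hw, rfl⟩

theorem wtPlus_mul_pow_mem_filtration {n k : ℕ} {e : ℤ} {j : ℕ}
    (h : n * e.natAbs + 2 * j ≤ k) :
    wtPlus q P e * genPlus q P .z ^ j ∈ filtration q P n k := by
  obtain ⟨m, rfl | rfl⟩ := e.eq_nat_or_neg
  · refine Submodule.subset_span ⟨List.replicate m .u ++ List.replicate j .z, ?_, ?_⟩
    · rw [Int.natAbs_natCast] at h
      simp only [List.map_append, List.map_replicate, List.sum_append, List.sum_replicate,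
        GenPlus.deg, smul_eq_mul]
      linarith
    · simp [wtPlus, wt_natCast]
  · refine Submodule.subset_span ⟨List.replicate m .v ++ List.replicate j .z, ?_, ?_⟩
    · rw [Int.natAbs_neg, Int.natAbs_natCast] at h
      simp only [List.map_append, List.map_replicate, List.sum_append, List.sum_replicate,
        GenPlus.deg, smul_eq_mul]
      linarith
    · simp [wtPlus, wt_neg_natCast]

theorem adjoin_genPlus (q : ℂ) (P : ℂ[X]) :
    Algebra.adjoin ℂ (Set.range (genPlus q P)) = ⊤ := by
  have h := Algebra.adjoin_adjoin_coe_preimage (R := ℂ)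
    (s := ({gen q P .u, gen q P .v, gen q P .z} : Set (A q P)))
  refine top_le_iff.1 (le_trans (ge_of_eq h) (Algebra.adjoin_mono ?_))
  rintro ⟨x, hx⟩ (h | h | h)
  · exact ⟨.u, Subtype.ext h.symm⟩
  · exact ⟨.v, Subtype.ext h.symm⟩
  · exact ⟨.z, Subtype.ext h.symm⟩

/-- The span contains 1 and is stable under left multiplication by the generators, hence is
everything. -/
theorem span_wtPlus_mul_pow (q : ℂ) (P : ℂ[X]) :
    Submodule.span ℂ (Set.range fun p : ℤ × ℕ => wtPlus q P p.1 * genPlus q P .z ^ p.2) = ⊤ := by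
  set W := Submodule.span ℂ (Set.range fun p : ℤ × ℕ => wtPlus q P p.1 * genPlus q P .z ^ p.2)
    with hW
  have h := weylRelations_genPlus q P
  have hle : ∀ k, monomialSpan P.natDegree (genPlus q P .u) (genPlus q P .v) (genPlus q P .z) k
      ≤ W := by
    intro k
    refine Submodule.span_mono ?_
    rintro _ ⟨e, j, -, rfl⟩
    exact ⟨(e, j), rfl⟩
  have hgen : ∀ x b, b ∈ W → genPlus q P x * b ∈ W := by
    intro x b hb
    have hb' : W ≤ W.comap (LinearMap.mulLeft ℂ (genPlus q P x)) := by
      refine Submodule.span_le.2 ?_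
      rintro _ ⟨⟨e, j⟩, rfl⟩
      have hm : wtPlus q P e * genPlus q P .z ^ j ∈ monomialSpan P.natDegree (genPlus q P .u)
          (genPlus q P .v) (genPlus q P .z) (P.natDegree * e.natAbs + 2 * j) :=
        Submodule.subset_span ⟨e, j, le_rfl, rfl⟩
      cases x
      · exact hle _ (h.u_mul_mem le_rfl hm)
      · exact hle _ (h.v_mul_mem le_rfl hm)
      · exact hle _ (h.z_mul_mem _ hm)
    exact hb' hb
  have hall : ∀ a : APlus q P, ∀ b ∈ W, a * b ∈ W := by
    intro a
    have ha : a ∈ Algebra.adjoin ℂ (Set.range (genPlus q P)) := by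
      rw [adjoin_genPlus]; trivial
    induction ha using Algebra.adjoin_induction with
    | mem x hx =>
      obtain ⟨x, rfl⟩ := hx
      exact hgen x
    | algebraMap r =>
      intro b hb
      rw [← Algebra.smul_def]
      exact Submodule.smul_mem _ _ hb
    | add x y _ _ hx hy =>
      intro b hb
      rw [add_mul]
      exact Submodule.add_mem _ (hx b hb) (hy b hb)
    | mul x y _ _ hx hy =>
      intro b hb
      rw [mul_assoc]
      exact hx _ (hy b hb)
  rw [eq_top_iff]
  intro a _
  have := hall a 1 (Submodule.subset_span ⟨(0, 0), by simp [wt_zero]⟩)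
  rwa [mul_one] at this

theorem linearMap_ext_wtPlus {T T' : APlus q P →ₗ[ℂ] ℂ}
    (h : ∀ e j, T (wtPlus q P e * genPlus q P .z ^ j) = T' (wtPlus q P e * genPlus q P .z ^ j)) :
    T = T' :=
  LinearMap.ext_on_range (span_wtPlus_mul_pow q P) fun p => h p.1 p.2

end APlus

/-! ### A representation that realizes arbitrary moments -/

section Representation

open LaurentPolynomial in
/-- The action of the generators of `𝒜` on functions `ℤ → ℂ[Z, Z⁻¹]`: `Z` multiplies by
`q²ᵏ Z`, `u` shifts, and `v` is the opposite shift followed by multiplication by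
`P(q²ᵏ⁺¹ Z)`. -/
noncomputable def repGen (q : ℂ) (P : ℂ[X]) : Gen → Module.End ℂ (ℤ → LaurentPolynomial ℂ)
  | .u => LinearMap.funLeft ℂ _ fun k => k - 1
  | .v => (Algebra.lmul ℂ (ℤ → LaurentPolynomial ℂ)
      (fun k => aeval (q • (q ^ (2 * k) • T 1 : LaurentPolynomial ℂ)) P)) *
        LinearMap.funLeft ℂ _ fun k => k + 1
  | .z => Algebra.lmul ℂ (ℤ → LaurentPolynomial ℂ) fun k => q ^ (2 * k) • T 1
  | .zInv => Algebra.lmul ℂ (ℤ → LaurentPolynomial ℂ) fun k => q ^ (-(2 * k)) • T (-1)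

theorem aeval_smul_lmul_apply (a : ℂ) (y φ : ℤ → LaurentPolynomial ℂ) (P : ℂ[X]) (k : ℤ) :
    aeval (a • Algebra.lmul ℂ (ℤ → LaurentPolynomial ℂ) y) P φ k = aeval (a • y k) P * φ k := by
  rw [← map_smul, Polynomial.aeval_algHom_apply]
  change aeval (a • y) P k * φ k = _
  congr 1
  exact (Polynomial.aeval_algHom_apply (Pi.evalAlgHom ℂ (fun _ : ℤ => LaurentPolynomial ℂ) k)
    (a • y) P).symm

theorem repGen_rel {q : ℂ} (hq : q ≠ 0) (P : ℂ[X]) ⦃x y : FreeAlgebra ℂ Gen⦄ (h : Rel q P x y) :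
    FreeAlgebra.lift ℂ (repGen q P) x = FreeAlgebra.lift ℂ (repGen q P) y := by
  have hl : ∀ x, FreeAlgebra.lift ℂ (repGen q P) (fg x) = repGen q P x :=
    fun x => FreeAlgebra.lift_ι_apply _ _
  have hT : (LaurentPolynomial.T 1 * LaurentPolynomial.T (-1) : LaurentPolynomial ℂ) = 1 := by
    rw [← LaurentPolynomial.T_add]; exact LaurentPolynomial.T_zero
  have hT' : (LaurentPolynomial.T (-1) * LaurentPolynomial.T 1 : LaurentPolynomial ℂ) = 1 := by
    rw [mul_comm, hT]
  cases h <;> refine LinearMap.ext fun φ => funext fun k => ?_ <;>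
    simp only [map_mul, map_one, map_smul, ← Polynomial.aeval_algHom_apply, hl]
  · change (q ^ (2 * k) • LaurentPolynomial.T 1) *
      ((q ^ (-(2 * k)) • LaurentPolynomial.T (-1)) * φ k) = φ k
    rw [← mul_assoc, smul_mul_smul_comm, hT, ← zpow_add₀ hq, add_neg_cancel, zpow_zero, one_smul,
      one_mul]
  · change (q ^ (-(2 * k)) • LaurentPolynomial.T (-1)) *
      ((q ^ (2 * k) • LaurentPolynomial.T 1) * φ k) = φ k
    rw [← mul_assoc, smul_mul_smul_comm, hT', ← zpow_add₀ hq, neg_add_cancel, zpow_zero, one_smul,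
      one_mul]
  · change (q ^ (2 * k) • LaurentPolynomial.T 1) *
      ((q ^ (-(2 * (k - 1))) • LaurentPolynomial.T (-1)) * φ (k - 1)) = q ^ 2 • φ (k - 1)
    rw [← mul_assoc, smul_mul_smul_comm, hT, ← zpow_add₀ hq, smul_mul_assoc, one_mul,
      show 2 * k + -(2 * (k - 1)) = ((2 : ℕ) : ℤ) by push_cast; ring, zpow_natCast]
  · change (q ^ (2 * k) • LaurentPolynomial.T 1) * (aeval (q • (q ^ (2 * k) •
      (LaurentPolynomial.T 1 : LaurentPolynomial ℂ))) P *
      ((q ^ (-(2 * (k + 1))) • LaurentPolynomial.T (-1)) * φ (k + 1))) =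
      (q ^ 2)⁻¹ • (aeval (q • (q ^ (2 * k) • (LaurentPolynomial.T 1 : LaurentPolynomial ℂ))) P *
        φ (k + 1))
    rw [mul_left_comm, ← mul_assoc (q ^ (2 * k) • _), smul_mul_smul_comm, hT, ← zpow_add₀ hq,
      smul_mul_assoc, one_mul, mul_smul_comm,
      show 2 * k + -(2 * (k + 1)) = -((2 : ℕ) : ℤ) by push_cast; ring, zpow_neg, zpow_natCast]
  · rw [repGen, repGen, repGen, aeval_smul_lmul_apply]
    change aeval (q • (q ^ (2 * (k - 1)) • (LaurentPolynomial.T 1 : LaurentPolynomial ℂ))) P *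
        φ (k - 1 + 1) = _
    rw [sub_add_cancel, smul_smul, smul_smul, ← zpow_one_add₀ hq, ← zpow_neg_one, ← zpow_add₀ hq]
    congr 5
    ring
  · rw [repGen, repGen, repGen, aeval_smul_lmul_apply]
    change aeval (q • (q ^ (2 * k) • (LaurentPolynomial.T 1 : LaurentPolynomial ℂ))) P *
        φ (k + 1 - 1) = _
    rw [add_sub_cancel_right]

/-- The representation of `𝒜` on functions `ℤ → ℂ[Z, Z⁻¹]`. -/
noncomputable def rep {q : ℂ} (hq : q ≠ 0) (P : ℂ[X]) :
    A q P →ₐ[ℂ] Module.End ℂ (ℤ → LaurentPolynomial ℂ) :=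
  RingQuot.liftAlgHom ℂ ⟨FreeAlgebra.lift ℂ (repGen q P), repGen_rel hq P⟩

theorem rep_gen {q : ℂ} (hq : q ≠ 0) (P : ℂ[X]) (x : Gen) :
    rep hq P (gen q P x) = repGen q P x := by
  rw [rep, gen, RingQuot.liftAlgHom_mkAlgHom_apply]
  exact FreeAlgebra.lift_ι_apply _ _

theorem repGen_u_pow_apply (q : ℂ) (P : ℂ[X]) (m : ℕ) (φ : ℤ → LaurentPolynomial ℂ) (k : ℤ)
    (h : φ (k - m) = 0) : (repGen q P .u ^ m) φ k = 0 := by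
  induction m generalizing k with
  | zero => simpa using h
  | succ m ih =>
    rw [pow_succ']
    exact ih (k - 1) (by rw [← h]; congr 1; push_cast; ring)

theorem repGen_v_pow_apply (q : ℂ) (P : ℂ[X]) (m : ℕ) (φ : ℤ → LaurentPolynomial ℂ) (k : ℤ)
    (h : φ (k + m) = 0) : (repGen q P .v ^ m) φ k = 0 := by
  induction m generalizing k with
  | zero => simpa using h
  | succ m ih =>
    rw [pow_succ']
    refine mul_eq_zero_of_right _ (ih (k + 1) ?_)
    rw [← h]; congr 1; push_cast; ring

theorem repGen_z_pow_apply (q : ℂ) (P : ℂ[X]) (j : ℕ) (φ : ℤ → LaurentPolynomial ℂ) (k : ℤ) :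
    (repGen q P .z ^ j) φ k = (q ^ (2 * k) • LaurentPolynomial.T 1) ^ j * φ k := by
  rw [repGen, ← map_pow]
  rfl

/-- Every sequence is the sequence of moments of a linear functional on `𝒜₊` that vanishes in
nonzero weights. -/
theorem exists_linearMap_moments {q : ℂ} (hq : q ≠ 0) (P : ℂ[X]) (m : ℕ → ℂ) :
    ∃ T : APlus q P →ₗ[ℂ] ℂ,
      (∀ e : ℤ, e ≠ 0 → ∀ j, T (wtPlus q P e * genPlus q P .z ^ j) = 0) ∧
        ∀ j, T (genPlus q P .z ^ j) = m j := by
  obtain ⟨r, hr⟩ := LinearMap.exists_leftInverse_of_injective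
    (Polynomial.toLaurentAlg (R := ℂ)).toLinearMap
    (LinearMap.ker_eq_bot.2 Polynomial.toLaurent_injective)
  -- Applied to `δ`, a monomial of weight `e` is supported at position `e`. Reading off position 0
  -- therefore kills nonzero weights and sends `Z ^ j` to the Laurent monomial, from which `r`
  -- recovers the polynomial `X ^ j`.
  let δ : ℤ → LaurentPolynomial ℂ := Pi.single 0 1
  have hδ : ∀ k ≠ 0, δ k = 0 := fun k hk => Pi.single_eq_of_ne hk _
  have hδ' : δ 0 = 1 := Pi.single_eq_same _ _
  let π : APlus q P →ₗ[ℂ] LaurentPolynomial ℂ :=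
    (LinearMap.proj (R := ℂ) (φ := fun _ : ℤ => LaurentPolynomial ℂ) 0) ∘ₗ
      (LinearMap.applyₗ (R := ℂ) δ) ∘ₗ (rep hq P).toLinearMap ∘ₗ (APlus q P).val.toLinearMap
  have hπ : ∀ a, π a = rep hq P (a : A q P) δ 0 := fun _ => rfl
  refine ⟨momentFunctional m ∘ₗ r ∘ₗ π, fun e he j => ?_, fun j => ?_⟩
  · have : π (wtPlus q P e * genPlus q P .z ^ j) = 0 := by
      rw [hπ]
      have hz : ∀ k : ℤ, k ≠ 0 → (repGen q P .z ^ j) δ k = 0 := fun k hk => by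
        rw [repGen_z_pow_apply, hδ k hk, mul_zero]
      obtain ⟨i, rfl | rfl⟩ := e.eq_nat_or_neg
      · rw [wtPlus, wt_natCast]
        simp only [Subalgebra.coe_mul, Subalgebra.coe_pow, genPlus, GenPlus.toGen, map_mul,
          map_pow, rep_gen]
        exact repGen_u_pow_apply _ _ _ _ _ (hz _ (by omega))
      · rw [wtPlus, wt_neg_natCast]
        simp only [Subalgebra.coe_mul, Subalgebra.coe_pow, genPlus, GenPlus.toGen, map_mul,
          map_pow, rep_gen]
        exact repGen_v_pow_apply _ _ _ _ _ (hz _ (by omega))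
    rw [LinearMap.comp_apply, LinearMap.comp_apply, this, map_zero, map_zero]
  · have : π (genPlus q P .z ^ j) = Polynomial.toLaurentAlg (R := ℂ) (X ^ j) := by
      rw [hπ]
      simp only [Subalgebra.coe_pow, genPlus, GenPlus.toGen, map_pow, rep_gen]
      rw [repGen_z_pow_apply, hδ']
      simp
    rw [LinearMap.comp_apply, LinearMap.comp_apply, this]
    have h := LinearMap.congr_fun hr (X ^ j)
    simp only [LinearMap.comp_apply, AlgHom.toLinearMap_apply, LinearMap.id_apply] at h
    rw [h, X_pow_eq_monomial, momentFunctional_monomial, one_mul]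

end Representation

/-! ### Twisted traces and moment sequences -/

section Trace

variable {q : ℂ} {P : ℂ[X]}

theorem apply_aeval_eq_momentFunctional (T : APlus q P →ₗ[ℂ] ℂ) (f : ℂ[X]) :
    T (aeval (genPlus q P .z) f) = momentFunctional (fun j => T (genPlus q P .z ^ j)) f := by
  induction f using Polynomial.induction_on' with
  | add f g hf hg => rw [map_add, map_add, map_add, hf, hg]
  | monomial i a =>
    rw [aeval_monomial, ← Algebra.smul_def, map_smul, momentFunctional_monomial, smul_eq_mul]

theorem apply_v_mul_pow_mul_u (T : APlus q P →ₗ[ℂ] ℂ) (j : ℕ) :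
    T (genPlus q P .v * genPlus q P .z ^ j * genPlus q P .u) =
      (q ^ 2) ^ j * T (genPlus q P .v * (genPlus q P .u * genPlus q P .z ^ j)) := by
  rw [mul_assoc, pow_mul_of_mul_eq_smul (weylRelations_genPlus q P).zu, mul_smul_comm, map_smul,
    smul_eq_mul]

theorem apply_u_mul_pow_mul_v (T : APlus q P →ₗ[ℂ] ℂ) (j : ℕ) :
    T (genPlus q P .u * genPlus q P .z ^ j * genPlus q P .v) =
      ((q ^ 2)⁻¹) ^ j * T (genPlus q P .u * (genPlus q P .v * genPlus q P .z ^ j)) := by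
  rw [mul_assoc, pow_mul_of_mul_eq_smul (weylRelations_genPlus q P).zv, mul_smul_comm, map_smul,
    smul_eq_mul]

/-- The defect of the twisted trace property for `a = u`, `b = v * Z ^ j` is the defect of the
moment recurrence. -/
theorem apply_u_mul_v_sub {n : ℕ} {c : Fin (n + 1) → ℂ} (hq : q ≠ 0) (t : ℂ)
    (T : APlus q (param c) →ₗ[ℂ] ℂ) (j : ℕ) :
    T (genPlus q (param c) .u * (genPlus q (param c) .v * genPlus q (param c) .z ^ j)) -
      t * T (genPlus q (param c) .v * genPlus q (param c) .z ^ j * genPlus q (param c) .u) =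
      q ^ j * ∑ i : Fin (n + 1),
        c i * (momentFactor q t (i + j) * T (genPlus q (param c) .z ^ (i + j : ℕ))) := by
  have h := weylRelations_genPlus q (param c)
  have hdeg : ∀ a : ℂ, ((param c).comp (C a * X)).natDegree < n + 1 := fun a =>
    Nat.lt_succ_of_le ((natDegree_comp_C_mul_X_le _ _).trans (natDegree_param_le c))
  rw [apply_v_mul_pow_mul_u, ← mul_assoc, ← mul_assoc (genPlus q (param c) .v), h.uv, h.vu,
    ← aeval_X_pow (R := ℂ) (genPlus q (param c) .z), ← map_mul, ← map_mul,
    apply_aeval_eq_momentFunctional, apply_aeval_eq_momentFunctional,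
    momentFunctional_mul_X_pow _ _ (hdeg _), momentFunctional_mul_X_pow _ _ (hdeg _),
    Finset.sum_range, Finset.sum_range, Finset.mul_sum, Finset.mul_sum, Finset.mul_sum,
    ← Finset.sum_sub_distrib]
  -- Termwise, `uv` contributes `q^{-i}` and `vu`, after commuting `u` past `Z ^ j`, contributes `t
  -- q^{i+2j}`; the difference is `q^j` times the moment factor at `i + j`.
  refine Finset.sum_congr rfl fun i _ => ?_
  rw [comp_C_mul_X_coeff, comp_C_mul_X_coeff, coeff_param, dif_pos i.2, Fin.eta, momentFactor,
    pow_add q, inv_pow, ← pow_mul, mul_comm 2 j, pow_mul]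
  have h1 := pow_ne_zero j hq
  have h2 := pow_ne_zero (i : ℕ) hq
  field_simp

theorem apply_eq_zero_of_weight {t : ℂˣ} (ht : ∀ e : ℤ, e ≠ 0 → (t : ℂ) ^ e ≠ 1)
    {T : APlus q P →ₗ[ℂ] ℂ} (hT : ∀ a, T (gPlus q P t a) = T a) {e : ℤ} (he : e ≠ 0)
    {a : APlus q P} (ha : gPlus q P t a = (t : ℂ) ^ e • a) : T a = 0 := by
  have h := hT a
  rw [ha, map_smul, smul_eq_mul] at h
  have h' : ((t : ℂ) ^ e - 1) * T a = 0 := by rw [sub_mul, h, one_mul, sub_self]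
  exact (mul_eq_zero.1 h').resolve_left (sub_ne_zero.2 (ht e he))

theorem IsTwistedTrace.apply_gPlus {t : ℂˣ} {T : APlus q P →ₗ[ℂ] ℂ} (hT : IsTwistedTrace t T)
    (a : APlus q P) : T (gPlus q P t a) = T a := by
  have := hT a 1
  rwa [mul_one, one_mul, eq_comm] at this

theorem wtPlus_one (q : ℂ) (P : ℂ[X]) : wtPlus q P 1 = genPlus q P .u := by simp [wtPlus, wt]

theorem wtPlus_neg_one (q : ℂ) (P : ℂ[X]) : wtPlus q P (-1) = genPlus q P .v := by
  simp [wtPlus, wt]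

/-- Twisted traces are the functionals that vanish in nonzero weights and whose moments satisfy
the recurrence `IsMomentSequence`. -/
theorem isTwistedTrace_iff {n : ℕ} {c : Fin (n + 1) → ℂ} (hq : q ≠ 0) {t : ℂˣ}
    (ht : ∀ e : ℤ, e ≠ 0 → (t : ℂ) ^ e ≠ 1) {T : APlus q (param c) →ₗ[ℂ] ℂ} :
    IsTwistedTrace t T ↔
      (∀ e : ℤ, e ≠ 0 → ∀ j, T (wtPlus q (param c) e * genPlus q (param c) .z ^ j) = 0) ∧
        IsMomentSequence q t c fun j => T (genPlus q (param c) .z ^ j) := by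
  set u := genPlus q (param c) .u with hu
  set v := genPlus q (param c) .v with hv
  set z := genPlus q (param c) .z with hz
  have hgu : gPlus q (param c) t u = (t : ℂ) • u := gPlus_genPlus t .u
  have hgv : gPlus q (param c) t v = (t : ℂ)⁻¹ • v := gPlus_genPlus t .v
  have hgz : gPlus q (param c) t z = (1 : ℂ) • z := gPlus_genPlus t .z
  have ht0 : (t : ℂ) ≠ 0 := t.ne_zero
  constructor
  · intro hT
    refine ⟨fun e he j => apply_eq_zero_of_weight ht hT.apply_gPlus he
      (gPlus_wtPlus_mul_pow t e j), fun j => ?_⟩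
    have h1 := apply_u_mul_v_sub hq t T j
    rw [hT, hgu, mul_smul_comm, map_smul, smul_eq_mul, sub_self] at h1
    exact (mul_eq_zero.1 h1.symm).resolve_left (pow_ne_zero _ hq)
  · rintro ⟨h0, hm⟩
    have hg : ∀ a, T (gPlus q (param c) t a) = T a := by
      intro a
      have : T ∘ₗ (gPlus q (param c) t).toLinearMap = T := by
        refine linearMap_ext_wtPlus fun e j => ?_
        rw [LinearMap.comp_apply, AlgHom.toLinearMap_apply, gPlus_wtPlus_mul_pow, map_smul,
          smul_eq_mul]
        by_cases he : e = 0
        · rw [he, zpow_zero, one_mul]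
        · rw [h0 e he, mul_zero]
      exact LinearMap.congr_fun this a
    have huv : ∀ j, T (u * (v * z ^ j)) = t * T (v * z ^ j * u) := by
      intro j
      have h1 := apply_u_mul_v_sub hq t T j
      rw [hm j, mul_zero] at h1
      exact sub_eq_zero.1 h1
    -- The condition for `a = v` is the one for `a = u` rescaled, so it adds no new recurrence.
    have hvu : ∀ j, T (v * (u * z ^ j)) = (t : ℂ)⁻¹ * T (u * z ^ j * v) := by
      intro j
      have h1 := huv j
      rw [apply_v_mul_pow_mul_u] at h1
      rw [apply_u_mul_pow_mul_v, h1, inv_pow]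
      have := pow_ne_zero j (pow_ne_zero 2 hq)
      field_simp
      rfl
    have hzero : ∀ {d e : ℤ} {x : APlus q (param c)} (j : ℕ), d + e ≠ 0 →
        gPlus q (param c) t x = (t : ℂ) ^ d • x →
        T (x * (wtPlus q (param c) e * z ^ j)) =
          T (wtPlus q (param c) e * z ^ j * gPlus q (param c) t x) := by
      intro d e x j hde hx
      rw [hx, mul_smul_comm, map_smul]
      rw [apply_eq_zero_of_weight ht hg hde (a := x * (wtPlus q (param c) e * z ^ j)),
        apply_eq_zero_of_weight ht hg hde (a := wtPlus q (param c) e * z ^ j * x), smul_zero]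
      · rw [map_mul, hx, gPlus_wtPlus_mul_pow, smul_mul_smul_comm, zpow_add₀ ht0, mul_comm]
      · rw [map_mul, hx, gPlus_wtPlus_mul_pow, smul_mul_smul_comm, zpow_add₀ ht0]
    have hgen : ∀ x b, T (genPlus q (param c) x * b) =
        T (b * gPlus q (param c) t (genPlus q (param c) x)) := by
      intro x b
      have : T ∘ₗ LinearMap.mulLeft ℂ (genPlus q (param c) x) =
          T ∘ₗ LinearMap.mulRight ℂ (gPlus q (param c) t (genPlus q (param c) x)) := by
        refine linearMap_ext_wtPlus fun e j => ?_
        simp only [LinearMap.comp_apply, LinearMap.mulLeft_apply, LinearMap.mulRight_apply]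
        cases x
        · by_cases he : 1 + e = 0
          · obtain rfl : e = -1 := by omega
            rw [wtPlus_neg_one, ← hu, hgu, mul_smul_comm, map_smul, smul_eq_mul]
            exact huv j
          · exact hzero j he (by rw [zpow_one]; exact hgu)
        · by_cases he : -1 + e = 0
          · obtain rfl : e = 1 := by omega
            rw [wtPlus_one, ← hv, hgv, mul_smul_comm, map_smul, smul_eq_mul]
            exact hvu j
          · exact hzero j he (by rw [zpow_neg_one]; exact hgv)
        · by_cases he : 0 + e = 0
          · obtain rfl : e = 0 := by omega
            rw [← hz, hgz, one_smul, wtPlus, wt_zero, one_mul, ← pow_succ, ← pow_succ']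
          · exact hzero j he (by rw [zpow_zero]; exact hgz)
      exact LinearMap.congr_fun this b
    -- The `a` satisfying the identity for all `b` form a subalgebra: for a product, move the
    -- factors around one at a time.
    intro a
    have ha : a ∈ Algebra.adjoin ℂ (Set.range (genPlus q (param c))) := by
      rw [adjoin_genPlus]; trivial
    induction ha using Algebra.adjoin_induction with
    | mem x hx =>
      obtain ⟨x, rfl⟩ := hx
      exact hgen x
    | algebraMap r =>
      intro b
      rw [AlgHom.commutes, Algebra.commutes]
    | add x y _ _ hx hy =>
      intro b
      rw [map_add, add_mul, mul_add, map_add, map_add, hx, hy]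
    | mul x y _ _ hx hy =>
      intro b
      rw [mul_assoc, hx, mul_assoc, hy, map_mul (gPlus q (param c) t), mul_assoc]

/-- Traces with prescribed initial values correspond to solutions of the recurrence. The second
clause identifies the moments, which turns Gram determinants into values of `hankel`. -/
theorem existsUnique_trace_and_moments {n : ℕ} (hq : q ≠ 0) {t : ℂˣ}
    (ht : ∀ e : ℤ, e ≠ 0 → (t : ℂ) ^ e ≠ 1) (hd : ∀ i, momentFactor q t i ≠ 0)
    {c : Fin (n + 1) → ℂ} (hc : c (Fin.last n) ≠ 0) (τ : Fin n → ℂ) :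
    (∃! T : APlus q (param c) →ₗ[ℂ] ℂ,
      IsTwistedTrace t T ∧ ∀ i : Fin n, T (genPlus q (param c) .z ^ (i : ℕ)) = τ i) ∧
    ∀ T : APlus q (param c) →ₗ[ℂ] ℂ,
      (IsTwistedTrace t T ∧ ∀ i : Fin n, T (genPlus q (param c) .z ^ (i : ℕ)) = τ i) →
      (fun j => T (genPlus q (param c) .z ^ j)) = moments q t (Sum.elim c τ) := by
  have hiff := fun m => isMomentSequence_iff hd (x := Sum.elim c τ) hc (m := m)
  have hmom : ∀ T : APlus q (param c) →ₗ[ℂ] ℂ,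
      (IsTwistedTrace t T ∧ ∀ i : Fin n, T (genPlus q (param c) .z ^ (i : ℕ)) = τ i) →
      (fun j => T (genPlus q (param c) .z ^ j)) = moments q t (Sum.elim c τ) := fun T hT =>
    (hiff _).1 ⟨((isTwistedTrace_iff hq ht).1 hT.1).2, hT.2⟩
  refine ⟨?_, hmom⟩
  obtain ⟨T, hT, hT'⟩ := exists_linearMap_moments hq (param c) (moments q t (Sum.elim c τ))
  have hm : (fun j => T (genPlus q (param c) .z ^ j)) = moments q t (Sum.elim c τ) := funext hT'
  obtain ⟨h1, h2⟩ := (hiff _).2 hm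
  refine ⟨T, ⟨(isTwistedTrace_iff hq ht).2 ⟨hT, h1⟩, h2⟩, fun T' hT2 => ?_⟩
  refine linearMap_ext_wtPlus fun e j => ?_
  by_cases he : e = 0
  · rw [he, wtPlus, wt_zero, one_mul, hT']
    exact congrFun (hmom T' hT2) j
  · rw [hT e he, ((isTwistedTrace_iff hq ht).1 hT2.1).1 e he]

/-! ### Gram matrices and nondegeneracy -/

/-- The Gram matrix of a twisted trace between weights `e` and `-e` is a Hankel matrix up to
scaling of rows and columns. -/
theorem IsTwistedTrace.exists_gram_eq (hq : q ≠ 0) {t : ℂˣ} {T : APlus q P →ₗ[ℂ] ℂ}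
    (hT : IsTwistedTrace t T) (e : ℤ) :
    ∃ α β : ℕ → ℂ, (∀ j, α j ≠ 0) ∧ (∀ l, β l ≠ 0) ∧ ∀ j l,
      T ((wtPlus q P e * genPlus q P .z ^ j) * (wtPlus q P (-e) * genPlus q P .z ^ l)) =
        α j * β l * momentFunctional (fun j => T (genPlus q P .z ^ j))
          (shiftProd q P e.natAbs * X ^ (j + l)) := by
  have h := weylRelations_genPlus q P
  have hq2 : ∀ M j : ℕ, (((q ^ 2)⁻¹) ^ M) ^ j ≠ 0 := fun M j =>
    pow_ne_zero _ (pow_ne_zero _ (inv_ne_zero (pow_ne_zero _ hq)))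
  have key : ∀ M j l : ℕ, T ((genPlus q P .u ^ M * genPlus q P .z ^ j) *
      (genPlus q P .v ^ M * genPlus q P .z ^ l)) =
      (((q ^ 2)⁻¹) ^ M) ^ j * momentFunctional (fun j => T (genPlus q P .z ^ j))
          (shiftProd q P M * X ^ (j + l)) := by
    intro M j l
    rw [← apply_aeval_eq_momentFunctional, map_mul (aeval (genPlus q P .z)), ← h.pow_u_mul_pow_v hq, map_pow, aeval_X,
      pow_add, mul_assoc, ← mul_assoc (genPlus q P .z ^ j),
      pow_mul_of_mul_eq_smul (mul_pow_of_mul_eq_smul h.zv M), smul_mul_assoc, mul_smul_comm,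
      map_smul, smul_eq_mul]
    simp only [mul_assoc]
  obtain ⟨M, rfl | rfl⟩ := e.eq_nat_or_neg
  · refine ⟨fun j => (((q ^ 2)⁻¹) ^ M) ^ j, fun _ => 1, hq2 M, fun _ => one_ne_zero,
      fun j l => ?_⟩
    rw [wtPlus, wtPlus, wt_natCast, wt_neg_natCast, key, Int.natAbs_natCast, mul_one]
  -- For negative weight, the trace property swaps the two arguments at the cost of `t ^ (-M)` and
  -- reduces to the positive case.
  · refine ⟨fun _ => (t : ℂ) ^ (-(M : ℤ)), fun l => (((q ^ 2)⁻¹) ^ M) ^ l,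
      fun _ => zpow_ne_zero _ t.ne_zero, hq2 M, fun j l => ?_⟩
    rw [hT, gPlus_wtPlus_mul_pow, mul_smul_comm, map_smul, neg_neg, wtPlus, wtPlus, wt_natCast,
      wt_neg_natCast, key, Int.natAbs_neg, Int.natAbs_natCast, smul_eq_mul, mul_assoc, add_comm]

theorem IsTwistedTrace.apply_mul_eq_zero {t : ℂˣ} (ht : ∀ e : ℤ, e ≠ 0 → (t : ℂ) ^ e ≠ 1)
    {T : APlus q P →ₗ[ℂ] ℂ} (hT : IsTwistedTrace t T) {e e' : ℤ} (he : e + e' ≠ 0) (j l : ℕ) :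
    T ((wtPlus q P e * genPlus q P .z ^ j) * (wtPlus q P e' * genPlus q P .z ^ l)) = 0 :=
  apply_eq_zero_of_weight ht hT.apply_gPlus he (by
    rw [map_mul, gPlus_wtPlus_mul_pow, gPlus_wtPlus_mul_pow, smul_mul_smul_comm,
      zpow_add₀ t.ne_zero])

/-- Pairing with monomials of weight `-e` isolates the weight `e` coefficients of `a`, and a
nonsingular Hankel block forces them to vanish. Linear independence of the monomials is not needed,
since the coefficients of any chosen expansion vanish. -/
theorem eq_zero_of_forall_apply_mul_eq_zero {n : ℕ} (hn : 0 < n) (hP : P.natDegree ≤ n)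
    (hq : q ≠ 0) {t : ℂˣ} (ht : ∀ e : ℤ, e ≠ 0 → (t : ℂ) ^ e ≠ 1) {T : APlus q P →ₗ[ℂ] ℂ}
    (hT : IsTwistedTrace t T)
    (hdet : ∀ M N, (Matrix.of fun j l : Fin N => momentFunctional
      (fun j => T (genPlus q P .z ^ j)) (shiftProd q P M * X ^ ((j : ℕ) + (l : ℕ)))).det ≠ 0)
    {k : ℕ} {a : APlus q P} (ha : a ∈ filtration q P n k)
    (h : ∀ b ∈ filtration q P n k, T (a * b) = 0) : a = 0 := by
  classical
  let S : Finset (ℤ × ℕ) := (Finset.Icc (-(k : ℤ)) k ×ˢ Finset.range (k + 1)).filter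
    fun p => n * p.1.natAbs + 2 * p.2 ≤ k
  have hS : ∀ p, p ∈ S ↔ n * p.1.natAbs + 2 * p.2 ≤ k := by
    intro p
    simp only [S, Finset.mem_filter, Finset.mem_product, Finset.mem_Icc, Finset.mem_range,
      and_iff_right_iff_imp]
    intro hp
    have := Nat.le_mul_of_pos_left p.1.natAbs hn
    omega
  let mon : ℤ × ℕ → APlus q P := fun p => wtPlus q P p.1 * genPlus q P .z ^ p.2
  have ha' : a ∈ Submodule.span ℂ (mon '' S) := by
    refine Submodule.span_mono ?_ (filtration_le_monomialSpan hP k ha)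
    rintro _ ⟨e, j, hk, rfl⟩
    exact ⟨(e, j), (hS _).2 hk, rfl⟩
  obtain ⟨f, hfS, hf⟩ := (Finsupp.mem_span_image_iff_linearCombination ℂ).1 ha'
  rw [Finsupp.linearCombination_apply, Finsupp.sum_of_support_subset f
    (by exact_mod_cast (Finsupp.mem_supported ℂ f).1 hfS) (fun p r => r • mon p) (fun i _ => zero_smul ℂ _)] at hf
  suffices hz : ∀ p ∈ S, f p = 0 by
    rw [← hf]
    exact Finset.sum_eq_zero fun p hp => by rw [hz p hp, zero_smul]
  rintro ⟨e, j₀⟩ hp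
  rw [hS] at hp
  dsimp only at hp
  -- The number of `j` with `n|e| + 2j ≤ k`. It is the same for `-e`, so the Gram block is square.
  let N := (k - n * e.natAbs) / 2 + 1
  obtain ⟨α, β, hα, hβ, hgram⟩ := hT.exists_gram_eq hq e
  have hvec : (fun j : Fin N => f (e, j) * α j) = 0 := by
    refine Matrix.eq_zero_of_vecMul_eq_zero (hdet e.natAbs N) (funext fun l => ?_)
    have hl : wtPlus q P (-e) * genPlus q P .z ^ (l : ℕ) ∈ filtration q P n k := by
      refine wtPlus_mul_pow_mem_filtration ?_
      have := l.2
      rw [Int.natAbs_neg]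
      omega
    have h1 := h _ hl
    rw [← hf, Finset.sum_mul, map_sum] at h1
    let ι : Fin N ↪ ℤ × ℕ := ⟨fun j => (e, (j : ℕ)), fun i j hij => by
      simpa [Fin.ext_iff] using hij⟩
    have hsub : Finset.univ.map ι ⊆ S := by
      intro p hp'
      obtain ⟨j, -, rfl⟩ := Finset.mem_map.1 hp'
      rw [hS]
      have := j.2
      change n * e.natAbs + 2 * (j : ℕ) ≤ k
      omega
    rw [← Finset.sum_subset hsub, Finset.sum_map] at h1
    · simp only [Matrix.vecMul, dotProduct, Matrix.of_apply, Pi.zero_apply]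
      have h2 : β l * ∑ j : Fin N, f (e, j) * α j * momentFunctional
          (fun j => T (genPlus q P .z ^ j)) (shiftProd q P e.natAbs * X ^ ((j : ℕ) + (l : ℕ))) =
          0 := by
        rw [← h1, Finset.mul_sum]
        refine Finset.sum_congr rfl fun j _ => ?_
        rw [smul_mul_assoc, map_smul, smul_eq_mul]
        refine Eq.trans ?_ (congrArg (f (e, (j : ℕ)) * ·) (hgram j l)).symm
        ring
      exact (mul_eq_zero.1 h2).resolve_left (hβ l)
    · intro p hpS hp'
      rw [smul_mul_assoc, map_smul, hT.apply_mul_eq_zero ht, smul_zero]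
      intro hpe
      refine hp' (Finset.mem_map.2 ⟨⟨p.2, ?_⟩, Finset.mem_univ _, ?_⟩)
      · rw [hS, show p.1 = e by omega] at hpS
        omega
      · exact Prod.ext (show e = p.1 by omega) rfl
  have h3 := congrFun hvec ⟨j₀, by omega⟩
  exact (mul_eq_zero.1 h3).resolve_right (hα _)

/-- Words are eigenvectors of `g_t` with nonzero eigenvalue, so the trace property exchanges the
left and right radicals on a filtration piece. -/
theorem exists_smul_gPlus_prod (t : ℂˣ) (w : List GenPlus) :
    ∃ r : ℂ, r ≠ 0 ∧ gPlus q P t (w.map (genPlus q P)).prod = r • (w.map (genPlus q P)).prod := by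
  induction w with
  | nil => exact ⟨1, one_ne_zero, by simp⟩
  | cons x w ih =>
    obtain ⟨r, hr, h⟩ := ih
    refine ⟨scal t x.toGen * r, mul_ne_zero ?_ hr, ?_⟩
    · cases x <;> simp [scal, GenPlus.toGen]
    · rw [List.map_cons, List.prod_cons, map_mul, h, gPlus_genPlus, smul_mul_smul_comm]

theorem isNondegenerateTrace_of_hankel {n : ℕ} (hn : 0 < n) (hP : P.natDegree ≤ n)
    (hq : q ≠ 0) {t : ℂˣ} (ht : ∀ e : ℤ, e ≠ 0 → (t : ℂ) ^ e ≠ 1) {T : APlus q P →ₗ[ℂ] ℂ}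
    (hT : IsTwistedTrace t T)
    (hdet : ∀ M N, (Matrix.of fun j l : Fin N => momentFunctional
      (fun j => T (genPlus q P .z ^ j)) (shiftProd q P M * X ^ ((j : ℕ) + (l : ℕ)))).det ≠ 0) :
    IsNondegenerateTrace n T := by
  intro k
  refine ⟨fun a h => Subtype.ext ?_, fun b h => Subtype.ext ?_⟩
  · exact eq_zero_of_forall_apply_mul_eq_zero hn hP hq ht hT hdet a.2 fun b hb => h ⟨b, hb⟩
  · refine eq_zero_of_forall_apply_mul_eq_zero hn hP hq ht hT hdet b.2 fun a ha => ?_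
    have hle : filtration q P n k ≤
        LinearMap.ker (T ∘ₗ LinearMap.mulLeft ℂ (b : APlus q P)) := by
      refine Submodule.span_le.2 ?_
      rintro _ ⟨w, hw, rfl⟩
      obtain ⟨r, hr, hg⟩ := exists_smul_gPlus_prod (q := q) (P := P) t w
      have h1 : T ((w.map (genPlus q P)).prod * b) = 0 :=
        h ⟨_, Submodule.subset_span ⟨w, hw, rfl⟩⟩
      rw [hT, hg, mul_smul_comm, map_smul] at h1
      exact (smul_eq_zero.1 h1).resolve_left hr
    exact hle ha

end Trace

/-! ### The exceptional sets and the theorem -/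

theorem countable_setOf_pow_eq_one : {t : ℂ | ∃ k : ℕ, t ^ (k + 1) = 1}.Countable := by
  rw [Set.ofPred_exists]
  refine Set.countable_iUnion fun k => ?_
  refine ((nthRoots (k + 1) (1 : ℂ)).toFinset.finite_toSet.subset fun t ht => ?_).countable
  rw [Finset.mem_coe, Multiset.mem_toFinset, mem_nthRoots (Nat.succ_pos k)]
  exact ht

end QWeyl

theorem mainTheorem3 (n : ℕ) (hn : 0 < n) (q : ℂ) (hq₀ : q ≠ 0) (hq : ‖q‖ ≠ 1) :
    ∃ Z : Set ℂ, Z.Countable ∧ (∀ l : ℕ, q ^ (-2 * (l : ℤ)) ∈ Z) ∧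
      ∀ t : ℂˣ, (t : ℂ) ∉ Z →
        ∃ X : Set (Fin (n + 1) ⊕ Fin n → ℂ), QWeyl.IsCountableUnionOfHypersurfaces X ∧
          ∀ (c : Fin (n + 1) → ℂ) (τ : Fin n → ℂ), Sum.elim c τ ∉ X →
            (∃! T : QWeyl.APlus q (QWeyl.param c) →ₗ[ℂ] ℂ,
              QWeyl.IsTwistedTrace t T ∧
                ∀ i : Fin n, T (QWeyl.genPlus q (QWeyl.param c) .z ^ (i : ℕ)) = τ i) ∧
            ∀ T : QWeyl.APlus q (QWeyl.param c) →ₗ[ℂ] ℂ,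
              (QWeyl.IsTwistedTrace t T ∧
                ∀ i : Fin n, T (QWeyl.genPlus q (QWeyl.param c) .z ^ (i : ℕ)) = τ i) →
              QWeyl.IsNondegenerateTrace n T := by
  obtain ⟨Z, hZ, hZ'⟩ := QWeyl.exists_countable_hankel_det_ne_zero hn hq₀ hq
  -- Three exclusions: zeros of the moment factors, roots of unity (so that nonzero weights die),
  -- and the `t` for which a Hankel determinant vanishes at the special point.
  refine ⟨Set.range (fun l : ℕ => q ^ (-2 * (l : ℤ))) ∪ {t : ℂ | ∃ k : ℕ, t ^ (k + 1) = 1} ∪ Z,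
    ((Set.countable_range _).union QWeyl.countable_setOf_pow_eq_one).union hZ,
    fun l => Or.inl (Or.inl ⟨l, rfl⟩), fun t ht => ?_⟩
  simp only [Set.mem_union, not_or] at ht
  obtain ⟨⟨ht1, ht2⟩, ht3⟩ := ht
  have hd : ∀ i, QWeyl.momentFactor q t i ≠ 0 := by
    intro i h
    refine ht1 ⟨i, ?_⟩
    rw [QWeyl.momentFactor, sub_eq_zero] at h
    have hqi := pow_ne_zero i hq₀
    change q ^ (-2 * (i : ℤ)) = t
    rw [show (-2 * (i : ℤ)) = -(((i + i : ℕ)) : ℤ) by push_cast; ring, zpow_neg, zpow_natCast,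
      pow_add, mul_inv, h]
    rw [mul_assoc, ← h, mul_inv_cancel₀ hqi, mul_one]
  have ht4 : ∀ e : ℤ, e ≠ 0 → (t : ℂ) ^ e ≠ 1 := by
    intro e he h
    refine ht2 ⟨e.natAbs - 1, ?_⟩
    rw [Nat.sub_add_cancel (by omega)]
    obtain ⟨m, rfl | rfl⟩ := e.eq_nat_or_neg
    · rwa [Int.natAbs_natCast, ← zpow_natCast]
    · rwa [Int.natAbs_neg, Int.natAbs_natCast, ← zpow_natCast, ← inv_eq_one, ← zpow_neg]
  obtain ⟨x₀, hx₀, hdet₀⟩ := hZ' t ht3 hd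
  have hex := fun p : ℕ × ℕ => QWeyl.exists_hypersurface_of_mem_regularFunctions
    (QWeyl.det_hankel_mem_regularFunctions q t (n := n) p.1 p.2) hx₀ (hdet₀ p.1 p.2)
  choose f hf hf' using hex
  refine ⟨⋃₀ Set.range fun p => {x | MvPolynomial.eval x (f p) = 0},
    ⟨_, Set.countable_range _, ?_, rfl⟩, fun c τ hx => ?_⟩
  · rintro _ ⟨p, rfl⟩
    exact ⟨f p, hf p, rfl⟩
  · have hx' : ∀ p : ℕ × ℕ, Sum.elim c τ (.inl (Fin.last n)) ≠ 0 ∧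
        (QWeyl.hankel q t p.1 p.2 (Sum.elim c τ)).det ≠ 0 := fun p =>
      hf' p _ fun h => hx (Set.mem_sUnion.2 ⟨_, ⟨p, rfl⟩, h⟩)
    -- Each hypersurface already contains the locus `c_n = 0`, so the index `(0, 0)` suffices to get
    -- a nonzero leading coefficient.
    obtain ⟨h1, h2⟩ := QWeyl.existsUnique_trace_and_moments hq₀ ht4 hd (hx' (0, 0)).1 τ
    refine ⟨h1, fun T hT => QWeyl.isNondegenerateTrace_of_hankel hn (QWeyl.natDegree_param_le c)
      hq₀ ht4 hT.1 fun M N => ?_⟩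
    rw [h2 T hT]
    exact (hx' (M, N)).2
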